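/- Let $m\ge 1$ be a fixed integer. The graph $G_{1,t}$ is the random multigraph on $\{1,\dots,t\}$ defined recursively as follows: $G_{1,1}$ is a single loop at vertex $1$, and $G_{1,t}$ arises from $G_{1,t-1}$ by adding the vertex $t$ and one edge from $t$ to a random vertex $X_t\in\{1,\dots,t\}$ with, conditionally on $G_{1,t-1}$, $$\mathbf P[X_t=i]=\frac{d(i,G_{1,t-1})}{2t-1}\quad(1\le i<t),\qquad \mathbf P[X_t=t]=\frac1{2t-1},$$ where $d$ denotes the degree (a loop counts twice). The preferential-attachment graph $G_{m,n}$ is the multigraph on $\{1,\dots,n\}$ obtained from $G_{1,mn}$ by merging, for each $a\in\{1,\dots,n\}$, the vertices $(a-1)m+1,\dots,am$ into the vertex $a$, keeping all edges. Its adjacency matrix $A$ has entries $A_{ij}$ = the number of edges between $i$ and $j$ for $i\ne j$, and $A_{ii}$ = the number of loops at $i$. Let $\mu_{m,n}=\frac1n\sum_{i=1}^n\delta_{\lambda_i}$, where $\lambda_1,\dots,\lambda_n$ are the eigenvalues of $A$, let $\bar\mu_{m,n}=\mathbf E[\mu_{m,n}]$ be the expected spectral measure, that is, $\int f\,d\bar\mu_{m,n}=\mathbf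 E\left[\int f\,d\mu_{m,n}\right]$, and let $C_k=C_k(m,n)=\int x^k\,d\bar\mu_{m,n}$ be the $k$-th expected spectral moment. Then $C_0=1$ for every $n\ge 1$ and, as $n\to\infty$ with $m$ (and $k$) fixed, $$C_1=\Theta\left(\frac{\log n}{n}\right),\qquad C_2=(1+o(1))\,2m,\qquad C_3=\Theta\left(n^{-1/2}\right),\qquad C_4=(1+o(1))\,2m(m+1)\log n,$$ and for every integer $k\ge 3$ $$C_{2k}=\Theta\left(n^{k/2-1}\right),\qquad C_{2k-1}=\Theta\left(n^{k/2-3/2}\right).$$ Consequently, without rescaling the higher moments blow up: $C_j\to\infty$ as $n\to\infty$ for $j=4$ and for every $j\ge 6$. -/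

import Mathlib

open Filter Asymptotics MeasureTheory
open scoped ENNReal

noncomputable section

/-- A finite multigraph (parallel edges and loops allowed) with vertex set `V` and edge set `E`:
each edge has two ends. The order of the two ends plays no role in what follows. -/
structure Multigraph (V E : Type) where
  ends : E → V × V

namespace Multigraph

/-- The degree of a vertex: the number of edge ends at it, so a loop counts twice. -/
def degree {V E : Type} [DecidableEq V] [Fintype E] (G : Multigraph V E) (v : V) : ℕ :=
  (Finset.univ.filter fun e => (G.ends e).1 = v).card +
    (Finset.univ.filter fun e => (G.ends e).2 = v).card

/-- The multigraph obtained by merging vertices along a map `f`; all edges are kept. -/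
def collapse {V W E : Type} (f : V → W) (G : Multigraph V E) : Multigraph W E where
  ends e := (f (G.ends e).1, f (G.ends e).2)

/-- The adjacency matrix: the entry `(i, j)` is the number of edges joining `i` and `j`; in
particular the entry `(i, i)` is the number of loops at `i`, each counted once. -/
def adjMatrix {V E : Type} [DecidableEq V] [Fintype E] (G : Multigraph V E) : Matrix V V ℝ :=
  Matrix.of fun i j =>
    ((Finset.univ.filter fun e => s((G.ends e).1, (G.ends e).2) = s(i, j)).card : ℝ)

theorem adjMatrix_isHermitian {V E : Type} [DecidableEq V] [Fintype E] (G : Multigraph V E) :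
    G.adjMatrix.IsHermitian := by
  ext i j
  simp [adjMatrix, or_comm]

/-- The spectral measure (empirical spectral distribution) of a multigraph: mass `1 / |V|` at every
eigenvalue of the adjacency matrix, with multiplicity. -/
def spectralMeasure {V E : Type} [Fintype V] [DecidableEq V] [Fintype E] (G : Multigraph V E) :
    Measure ℝ :=
  (Fintype.card V : ℝ≥0∞)⁻¹ • ∑ i, Measure.dirac (G.adjMatrix_isHermitian.eigenvalues i)

theorem sum_degree {V E : Type} [Fintype V] [DecidableEq V] [Fintype E] (G : Multigraph V E) :
    ∑ v, G.degree v = 2 * Fintype.card E := by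
  have h : ∀ f : E → V, ∑ v, (Finset.univ.filter fun e => f e = v).card = Fintype.card E := by
    intro f
    rw [← Finset.card_univ]
    exact (Finset.card_eq_sum_card_fiberwise (fun _ _ => Finset.mem_univ _)).symm
  unfold degree
  rw [Finset.sum_add_distrib, h fun e => (G.ends e).1, h fun e => (G.ends e).2]
  ring

end Multigraph

/-- Vertices are numbered from `0`. The multigraph on `t` vertices in which every vertex `s` sends
one edge, to the vertex `X s`. -/
def attachmentGraph {t : ℕ} (X : Fin t → Fin t) : Multigraph (Fin t) (Fin t) where
  ends s := (s, X s)

/-- The weights with which a new vertex, added to a graph `G` on `t` vertices, chooses its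
neighbour: `degree / (2 t + 1)` for an old vertex and `1 / (2 t + 1)` for the new vertex itself. -/
def attachmentWeight {t : ℕ} (G : Multigraph (Fin t) (Fin t)) (i : Fin (t + 1)) : ℝ≥0∞ :=
  Fin.lastCases (motive := fun _ => ℝ≥0∞) (1 / (2 * (t : ℝ≥0∞) + 1))
    (fun j => (G.degree j : ℝ≥0∞) / (2 * (t : ℝ≥0∞) + 1)) i

theorem sum_attachmentWeight {t : ℕ} (G : Multigraph (Fin t) (Fin t)) :
    ∑ i, attachmentWeight G i = 1 := by
  have h := G.sum_degree
  rw [Fintype.card_fin] at h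
  rw [Fin.sum_univ_castSucc]
  simp only [attachmentWeight, Fin.lastCases_castSucc, Fin.lastCases_last, div_eq_mul_inv]
  rw [← Finset.sum_mul, ← add_mul, ← Nat.cast_sum, h]
  push_cast
  refine ENNReal.mul_inv_cancel (by simp) ?_
  exact_mod_cast ENNReal.natCast_ne_top (2 * t + 1)

/-- The law of the neighbour chosen by a new vertex. -/
def attachmentLaw {t : ℕ} (G : Multigraph (Fin t) (Fin t)) : PMF (Fin (t + 1)) :=
  PMF.ofFintype (attachmentWeight G) (sum_attachmentWeight G)

/-- The law of the sequence `X` of chosen neighbours after `t` vertices have been added one by one,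
starting from no vertex (so that the first vertex receives a loop). The preferential-attachment
graph with one edge per vertex is `attachmentGraph X`. -/
def prefAttachLaw : (t : ℕ) → PMF (Fin t → Fin t)
  | 0 => PMF.pure Fin.elim0
  | t + 1 => (prefAttachLaw t).bind fun X =>
      (attachmentLaw (attachmentGraph X)).map fun i =>
        Fin.snoc (α := fun _ => Fin (t + 1)) (fun s => (X s).castSucc) i

/-- The preferential-attachment graph with `n` vertices and `m` edges per vertex, for given choices
`X`: in the graph on `n * m` vertices, consecutive groups of `m` vertices (`i` with the same
value of `i / m`) are merged. -/
def prefAttachGraph (m n : ℕ) (X : Fin (n * m) → Fin (n * m)) :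
    Multigraph (Fin n) (Fin (n * m)) :=
  (attachmentGraph X).collapse Fin.divNat

/-- The expected spectral measure of the preferential-attachment graph: the average of the spectral
measures over the law of the random graph. -/
def expectedSpectralMeasure (m n : ℕ) : Measure ℝ :=
  ∑ X, prefAttachLaw (n * m) X • (prefAttachGraph m n X).spectralMeasure

/-- The `k`-th expected spectral moment of the preferential-attachment graph. -/
def spectralMoment (m k n : ℕ) : ℝ :=
  ∫ x, x ^ k ∂(expectedSpectralMeasure m n)

end

/-! The moment of order k is n⁻¹ E tr A^k (`spectralMoment_eq`), and the trace counts closed walks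
of length k with multiplicity (`trace_blockMatrix_pow`). Everything therefore rests on the
probability that prescribed edges are present together.

That probability is at most a constant times the product of 1/√(ij) over the edges ij
(`attachExp_prod_indicator_le`), as if edges were independent. The mechanism is that products of
rising factorials of degrees are eigenfunctions of the attachment step, and that prescribing an edge
to y multiplies by the degree of y, which only raises one rising factorial by one. Hence a stronger
statement carrying such a product can be proved by induction on time (`attachExp_joint_moment_le`).

Summed over walks of a given coincidence pattern, the product of edge weights is at most a product
over the distinct vertices of ∑ i^(-d/2), where d is the degree in the simple graph traced by the
walk: at most 2√n for d = 1, of order log n for d = 2, bounded for d ≥ 3. So the number of leaves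
decides. A walk enters a leaf and leaves it by the same edge, so outside the two-vertex case a
closed walk of length k has at most ⌊k/2⌋ leaves. With fewer leaves, a spare √n absorbs all
logarithms. With equality the walk goes around a star, whose centre has degree at least 3 unless k =
4 (`walkLeaves_cases`). This yields the upper bound n⁻¹ √n^⌊k/2⌋ for k ≥ 3, k ≠ 4.

The matching lower bound comes from the first vertex alone: its expected degree is at least of order
√n, Jensen's inequality passes to powers, and a power of its degree bounds the trace from below, its
loop supplying the extra step in odd length (`spectralMoment_ge`).

The low moments need sharper counts. The first counts loops. The second is total degree minus loops
plus a contribution of multiple edges, which is O(log² n) before division by n. In the fourth, walks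
that return after two steps to their first or second vertex give twice the sum of squared degrees up
to O(n), and all others contribute only powers of log n. For a merged vertex of degree D, the
quantity D(D+1) has an exactly solvable expectation, whose sum is m(m+1) n log n + O(n)
(`exists_abs_sum_blockDegree_sub_le`). -/

/-! ### The expectation over attachment sequences -/

/-- The number of indices `s < t` with `x s = v`. -/
def hits (t : ℕ) (x : ℕ → ℕ) (v : ℕ) : ℕ := ((Finset.range t).filter fun s => x s = v).card

/-- The probability that vertex `t` attaches to `i`, given the choices `x` of the vertices before
`t`. -/
noncomputable def stepProb (t : ℕ) (x : ℕ → ℕ) (i : ℕ) : ℝ := (1 + hits t x i) / (2 * t + 1)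

/-- The expectation of `f` over the random attachment sequence of length `t`, extended by zero. -/
noncomputable def attachExp : ℕ → ((ℕ → ℕ) → ℝ) → ℝ
  | 0, f => f fun _ => 0
  | t + 1, f => attachExp t fun x =>
      ∑ i ∈ Finset.range (t + 1), stepProb t x i * f (Function.update x t i)

/-- Each of the first `t` vertices attaches to itself or to an earlier vertex. -/
def IsAttachSeq (t : ℕ) (x : ℕ → ℕ) : Prop := ∀ s < t, x s ≤ s

theorem hits_update_of_le {t u i v : ℕ} {x : ℕ → ℕ} (h : u ≤ t) :
    hits u (Function.update x t i) v = hits u x v := by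
  unfold hits
  congr 1
  refine Finset.filter_congr fun s hs => ?_
  rw [Function.update_of_ne]
  have := Finset.mem_range.1 hs
  omega

theorem hits_succ (t : ℕ) (x : ℕ → ℕ) (v : ℕ) :
    hits (t + 1) x v = hits t x v + if x t = v then 1 else 0 := by
  unfold hits
  rw [Finset.range_add_one, Finset.filter_insert]
  split_ifs with h
  · rw [Finset.card_insert_of_notMem (by simp)]
  · simp

theorem hits_succ_update (t : ℕ) (x : ℕ → ℕ) (i v : ℕ) :
    hits (t + 1) (Function.update x t i) v = hits t x v + if i = v then 1 else 0 := by
  rw [hits_succ, hits_update_of_le le_rfl, Function.update_self]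

theorem IsAttachSeq.update {t i : ℕ} {x : ℕ → ℕ} (hx : IsAttachSeq t x) (hi : i ≤ t) :
    IsAttachSeq (t + 1) (Function.update x t i) := by
  intro s hs
  rcases eq_or_ne s t with rfl | h
  · simpa using hi
  · rw [Function.update_of_ne h]
    exact hx s (by omega)

theorem IsAttachSeq.hits_eq_zero {t v : ℕ} {x : ℕ → ℕ} (hx : IsAttachSeq t x) (hv : t ≤ v) :
    hits t x v = 0 := by
  unfold hits
  rw [Finset.card_eq_zero, Finset.filter_eq_empty_iff]
  intro s hs
  have h1 := Finset.mem_range.1 hs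
  have h2 := hx s h1
  omega

theorem sum_hits {t u : ℕ} {x : ℕ → ℕ} (hx : IsAttachSeq t x) (h : t ≤ u) :
    ∑ i ∈ Finset.range u, hits t x i = t := by
  unfold hits
  rw [← Finset.card_eq_sum_card_fiberwise, Finset.card_range]
  intro s hs
  have h1 := Finset.mem_range.1 hs
  have h2 := hx s h1
  simp only [Finset.coe_range, Set.mem_Iio]
  omega

theorem stepProb_nonneg (t : ℕ) (x : ℕ → ℕ) (i : ℕ) : 0 ≤ stepProb t x i := by
  unfold stepProb; positivity

theorem sum_stepProb {t : ℕ} {x : ℕ → ℕ} (hx : IsAttachSeq t x) :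
    ∑ i ∈ Finset.range (t + 1), stepProb t x i = 1 := by
  unfold stepProb
  rw [← Finset.sum_div, Finset.sum_add_distrib, ← Nat.cast_sum, sum_hits hx (by omega)]
  have : (2 * (t : ℝ) + 1) ≠ 0 := by positivity
  simp only [Finset.sum_const, Finset.card_range, nsmul_eq_mul, mul_one]
  push_cast
  field_simp
  ring

/-- The recursion evaluates its argument only at attachment sequences, so a comparison there
suffices; later estimates may thus use that edges point backwards. -/
theorem attachExp_mono {t : ℕ} {f g : (ℕ → ℕ) → ℝ} (h : ∀ x, IsAttachSeq t x → f x ≤ g x) :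
    attachExp t f ≤ attachExp t g := by
  induction t generalizing f g with
  | zero => exact h _ fun s hs => by omega
  | succ t ih =>
    refine ih fun x hx => Finset.sum_le_sum fun i hi => ?_
    exact mul_le_mul_of_nonneg_left
      (h _ (hx.update (by have := Finset.mem_range.1 hi; omega))) (stepProb_nonneg _ _ _)

theorem attachExp_congr {t : ℕ} {f g : (ℕ → ℕ) → ℝ} (h : ∀ x, IsAttachSeq t x → f x = g x) :
    attachExp t f = attachExp t g :=
  le_antisymm (attachExp_mono fun x hx => (h x hx).le) (attachExp_mono fun x hx => (h x hx).ge)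

theorem attachExp_add (t : ℕ) (f g : (ℕ → ℕ) → ℝ) :
    attachExp t (fun x => f x + g x) = attachExp t f + attachExp t g := by
  induction t generalizing f g with
  | zero => rfl
  | succ t ih =>
    simp only [attachExp, mul_add, Finset.sum_add_distrib]
    exact ih _ _

theorem attachExp_const_mul (t : ℕ) (c : ℝ) (f : (ℕ → ℕ) → ℝ) :
    attachExp t (fun x => c * f x) = c * attachExp t f := by
  induction t generalizing f with
  | zero => rfl
  | succ t ih =>
    simp only [attachExp]
    rw [← ih]
    congr 1
    ext x
    rw [Finset.mul_sum]
    exact Finset.sum_congr rfl fun i _ => by ring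

theorem attachExp_const (t : ℕ) (c : ℝ) : attachExp t (fun _ => c) = c := by
  induction t with
  | zero => rfl
  | succ t ih =>
    rw [attachExp]
    refine Eq.trans (attachExp_congr fun x hx => ?_) ih
    rw [← Finset.sum_mul, sum_stepProb hx, one_mul]

theorem attachExp_sub (t : ℕ) (f g : (ℕ → ℕ) → ℝ) :
    attachExp t (fun x => f x - g x) = attachExp t f - attachExp t g := by
  have h := attachExp_add t f fun x => -1 * g x
  rw [attachExp_const_mul] at h
  simp only [neg_mul, one_mul, ← sub_eq_add_neg] at h
  exact h

theorem attachExp_sum {ι : Type*} (t : ℕ) (s : Finset ι) (f : ι → (ℕ → ℕ) → ℝ) :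
    attachExp t (fun x => ∑ i ∈ s, f i x) = ∑ i ∈ s, attachExp t (f i) := by
  classical
  induction s using Finset.induction_on with
  | empty => simpa using attachExp_const t 0
  | insert a s ha ih =>
    rw [Finset.sum_insert ha, ← ih, ← attachExp_add]
    congr 1
    ext x
    rw [Finset.sum_insert ha]

theorem attachExp_nonneg {t : ℕ} {f : (ℕ → ℕ) → ℝ} (h : ∀ x, IsAttachSeq t x → 0 ≤ f x) :
    0 ≤ attachExp t f := by
  simpa only [attachExp_const] using attachExp_mono (f := fun _ => 0) h

/-- Jensen's inequality for powers. -/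
theorem pow_attachExp_le {t : ℕ} {f : (ℕ → ℕ) → ℝ} (h : ∀ x, IsAttachSeq t x → 0 ≤ f x) (k : ℕ) :
    attachExp t f ^ k ≤ attachExp t fun x => f x ^ k := by
  set c := attachExp t f with hc
  have hc0 : 0 ≤ c := attachExp_nonneg h
  rcases k with _ | k
  · simp [attachExp_const]
  rcases hc0.eq_or_lt with h0 | hpos
  · rw [← h0, zero_pow (by omega)]
    exact attachExp_nonneg fun x hx => pow_nonneg (h x hx) _
  -- Bernoulli's inequality at `f x / c - 1` gives the tangent line of the power at the mean `c`;
  -- its linear term has expectation zero.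
  have key : ∀ x, IsAttachSeq t x →
      c ^ (k + 1) + (k + 1) * c ^ k * (f x - c) ≤ f x ^ (k + 1) := by
    intro x hx
    have h1 := one_add_mul_le_pow (a := f x / c - 1) (by
      have := div_nonneg (h x hx) hc0
      linarith) (k + 1)
    have h2 : (1 + (f x / c - 1)) ^ (k + 1) * c ^ (k + 1) = f x ^ (k + 1) := by
      rw [← mul_pow]; congr 1; field_simp; ring
    have h3 := mul_le_mul_of_nonneg_right h1 (pow_nonneg hc0 (k + 1))
    rw [h2] at h3
    refine le_trans (le_of_eq ?_) h3
    push_cast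
    field_simp
    ring
  refine le_trans (le_of_eq ?_) (attachExp_mono key)
  rw [attachExp_add, attachExp_const, attachExp_const_mul, attachExp_sub, attachExp_const, ← hc]
  ring

/-- The extension by zero of a choice function. -/
def extendSeq {t : ℕ} (X : Fin t → Fin t) (s : ℕ) : ℕ := if h : s < t then X ⟨s, h⟩ else 0

theorem extendSeq_apply {t : ℕ} (X : Fin t → Fin t) (s : Fin t) : extendSeq X s = X s := by
  simp [extendSeq]

theorem extendSeq_snoc {t : ℕ} (X : Fin t → Fin t) (i : Fin (t + 1)) :
    extendSeq (Fin.snoc (α := fun _ => Fin (t + 1)) (fun s => (X s).castSucc) i) =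
      Function.update (extendSeq X) t i := by
  ext s
  rcases lt_trichotomy s t with h | h | h
  · rw [Function.update_of_ne h.ne]
    simp [extendSeq, Fin.snoc, h, Nat.lt_succ_of_lt h]
  · subst h
    simp [extendSeq, Fin.snoc]
  · rw [Function.update_of_ne h.ne']
    simp [extendSeq, show ¬ s < t by omega, show ¬ s < t + 1 by omega]

theorem hits_extendSeq {t : ℕ} (X : Fin t → Fin t) (j : ℕ) :
    hits t (extendSeq X) j = (Finset.univ.filter fun s => (X s : ℕ) = j).card := by
  unfold hits
  rw [← Nat.Iio_eq_range, ← Fin.map_valEmbedding_univ, Finset.filter_map, Finset.card_map]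
  congr 1
  refine Finset.filter_congr fun s _ => ?_
  simp [extendSeq_apply]

/-- One formula covers both kinds of target: an old vertex has its own outgoing end plus its hits as
degree, and the new vertex has no hits yet. -/
theorem toReal_attachmentWeight {t : ℕ} (X : Fin t → Fin t) (i : Fin (t + 1)) :
    (attachmentWeight (attachmentGraph X) i).toReal = stepProb t (extendSeq X) i := by
  have h1 : (2 * (t : ℝ≥0∞) + 1).toReal = 2 * t + 1 := by
    rw [ENNReal.toReal_add (by finiteness) (by finiteness)]
    simp
  induction i using Fin.lastCases with
  | last =>
    rw [attachmentWeight, Fin.lastCases_last, ENNReal.toReal_div, h1]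
    have : hits t (extendSeq X) (Fin.last t : Fin (t + 1)) = 0 := by
      rw [hits_extendSeq, Finset.card_eq_zero, Finset.filter_eq_empty_iff]
      intro s _
      have := (X s).isLt
      simp only [Fin.val_last]
      omega
    rw [stepProb, this]
    simp
  | cast j =>
    rw [attachmentWeight, Fin.lastCases_castSucc, ENNReal.toReal_div, h1, stepProb, hits_extendSeq]
    have : (attachmentGraph X).degree j = 1 + (Finset.univ.filter fun s => (X s : ℕ) = j).card := by
      simp only [Multigraph.degree, attachmentGraph, Fin.ext_iff]
      rw [show (Finset.univ.filter fun a : Fin t => (a : ℕ) = j) = {j} by ext; simp [Fin.ext_iff]]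
      simp
    rw [this, ENNReal.toReal_natCast]
    simp

theorem isAttachSeq_of_mem_support {t : ℕ} {X : Fin t → Fin t} (hX : prefAttachLaw t X ≠ 0) :
    IsAttachSeq t (extendSeq X) := by
  induction t with
  | zero => intro s hs; omega
  | succ t ih =>
    rw [← PMF.mem_support_iff, prefAttachLaw, PMF.mem_support_bind_iff] at hX
    obtain ⟨Y, hY, hX⟩ := hX
    rw [PMF.mem_support_map_iff] at hX
    obtain ⟨i, -, rfl⟩ := hX
    rw [extendSeq_snoc]
    exact (ih hY).update (by omega)

/-- The bridge from the probability mass function to the recursive functional. The law at `t + 1` is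
written as a double sum over the old sequence and the last choice, and summing over the new sequence
first collapses it. -/
theorem sum_prefAttachLaw_eq_attachExp (t : ℕ) (f : (ℕ → ℕ) → ℝ) :
    ∑ X, (prefAttachLaw t X).toReal * f (extendSeq X) = attachExp t f := by
  induction t generalizing f with
  | zero =>
    rw [Fintype.sum_unique]
    have : extendSeq (default : Fin 0 → Fin 0) = fun _ => 0 := by ext s; simp [extendSeq]
    rw [this, prefAttachLaw, PMF.pure_apply, if_pos (Subsingleton.elim _ _)]
    simp [attachExp]
  | succ t ih =>
    rw [attachExp, ← ih]
    have h1 : ∀ Y : Fin (t + 1) → Fin (t + 1), (prefAttachLaw (t + 1) Y).toReal =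
        ∑ X, ∑ i, if Y = Fin.snoc (α := fun _ => Fin (t + 1)) (fun s => (X s).castSucc) i then
          (prefAttachLaw t X).toReal * stepProb t (extendSeq X) i else 0 := by
      intro Y
      rw [prefAttachLaw, PMF.bind_apply, tsum_fintype, ENNReal.toReal_sum]
      · refine Finset.sum_congr rfl fun X _ => ?_
        rw [ENNReal.toReal_mul, PMF.map_apply, tsum_fintype, ENNReal.toReal_sum, Finset.mul_sum]
        · refine Finset.sum_congr rfl fun i _ => ?_
          split_ifs with h
          · rw [attachmentLaw, PMF.ofFintype_apply, toReal_attachmentWeight]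
          · simp
        · intro i _
          split_ifs
          · exact PMF.apply_ne_top _ _
          · simp
      · intro X _
        exact ENNReal.mul_ne_top (PMF.apply_ne_top _ _) (PMF.apply_ne_top _ _)
    simp only [h1, Finset.sum_mul]
    rw [Finset.sum_comm]
    refine Finset.sum_congr rfl fun X _ => ?_
    rw [Finset.sum_comm, Finset.sum_range, Finset.mul_sum]
    refine Finset.sum_congr rfl fun i _ => ?_
    simp only [ite_mul, zero_mul]
    rw [Finset.sum_ite_eq' Finset.univ, if_pos (Finset.mem_univ _), extendSeq_snoc, mul_assoc]

/-! ### Joint attachment probabilities -/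

theorem mul_succ_ascFactorial (d r : ℕ) : d * (d + 1).ascFactorial r = d.ascFactorial (r + 1) := by
  rw [Nat.succ_ascFactorial, Nat.ascFactorial_succ]

/-- Choosing `i` with probability proportional to its degree is absorbed exactly by a rising
factorial, because d (d+1)⋯(d+r) is the next one. Plain powers would leave error terms. -/
theorem prod_ascFactorial_hit {T i : ℕ} (hi : i < T) (d r : ℕ → ℕ) :
    d i * ∏ v ∈ Finset.range T, (d v + if i = v then 1 else 0).ascFactorial (r v) =
      ∏ v ∈ Finset.range T, (d v).ascFactorial (Function.update r i (r i + 1) v) := by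
  have hi' := Finset.mem_range.2 hi
  rw [← Finset.mul_prod_erase _ _ hi', ← Finset.mul_prod_erase _ _ hi', ← mul_assoc, if_pos rfl,
    mul_succ_ascFactorial, Function.update_self]
  congr 1
  refine Finset.prod_congr rfl fun v hv => ?_
  have hv' := Finset.ne_of_mem_erase hv
  rw [if_neg hv'.symm, Function.update_of_ne hv', add_zero]

theorem prod_ascFactorial_update {T i : ℕ} (hi : i < T) (d r : ℕ → ℕ) :
    ∏ v ∈ Finset.range T, (d v).ascFactorial (Function.update r i (r i + 1) v) =
      (d i + r i) * ∏ v ∈ Finset.range T, (d v).ascFactorial (r v) := by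
  have hi' := Finset.mem_range.2 hi
  rw [← Finset.mul_prod_erase _ _ hi', ← Finset.mul_prod_erase _ _ hi', ← mul_assoc,
    Function.update_self, Nat.ascFactorial_succ]
  congr 1
  refine Finset.prod_congr rfl fun v hv => ?_
  rw [Function.update_of_ne (Finset.ne_of_mem_erase hv)]

theorem prod_ascFactorial_miss {T i : ℕ} (hi : T ≤ i) (d r : ℕ → ℕ) :
    ∏ v ∈ Finset.range T, (d v + if i = v then 1 else 0).ascFactorial (r v) =
      ∏ v ∈ Finset.range T, (d v).ascFactorial (r v) := by
  refine Finset.prod_congr rfl fun v hv => ?_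
  have := Finset.mem_range.1 hv
  rw [if_neg (by omega), add_zero]

/-- Products of rising factorials of degrees are eigenfunctions of the attachment step. -/
theorem sum_stepProb_mul_prod_ascFactorial {T : ℕ} {x : ℕ → ℕ} (hx : IsAttachSeq T x)
    (r : ℕ → ℕ) :
    ∑ i ∈ Finset.range (T + 1), stepProb T x i *
        ((∏ v ∈ Finset.range T, (1 + hits T x v + if i = v then 1 else 0).ascFactorial (r v) : ℕ) : ℝ)
      = (1 + ∑ v ∈ Finset.range T, (r v : ℝ) / (2 * T + 1)) *
        ((∏ v ∈ Finset.range T, (1 + hits T x v).ascFactorial (r v) : ℕ) : ℝ) := by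
  have hpos : (2 * (T : ℝ) + 1) ≠ 0 := by positivity
  have h1 : ∀ i ∈ Finset.range T, stepProb T x i *
      ((∏ v ∈ Finset.range T, (1 + hits T x v + if i = v then 1 else 0).ascFactorial (r v) : ℕ) : ℝ)
      = ((1 + hits T x i + r i : ℕ) : ℝ) / (2 * T + 1) *
        ((∏ v ∈ Finset.range T, (1 + hits T x v).ascFactorial (r v) : ℕ) : ℝ) := by
    intro i hi
    have h2 := prod_ascFactorial_hit (Finset.mem_range.1 hi) (fun v => 1 + hits T x v) r
    rw [prod_ascFactorial_update (Finset.mem_range.1 hi) (fun v => 1 + hits T x v) r] at h2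
    rw [div_mul_eq_mul_div, ← Nat.cast_mul, ← h2, stepProb, div_mul_eq_mul_div]
    push_cast
    rfl
  rw [Finset.sum_range_succ, Finset.sum_congr rfl h1,
    prod_ascFactorial_miss le_rfl (fun v => 1 + hits T x v), ← Finset.sum_mul, ← Finset.sum_div,
    ← Finset.sum_div, ← add_mul, ← Nat.cast_sum, Finset.sum_add_distrib, Finset.sum_add_distrib,
    sum_hits hx le_rfl, stepProb, hx.hits_eq_zero le_rfl]
  congr 1
  simp only [Finset.sum_const, Finset.card_range, smul_eq_mul, mul_one]
  push_cast
  field_simp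
  ring

/-- The mean growth of a degree in one step is dominated by that of the square root, since (2T+2)²
(2T-1) ≤ (2T+1)³. -/
theorem one_add_inv_mul_sqrt_le {T v : ℕ} (h : v < T) :
    (1 + 1 / (2 * (T : ℝ) + 1)) * √((2 * T - 1) / (2 * v + 1)) ≤ √((2 * T + 1) / (2 * v + 1)) := by
  have hT : (1 : ℝ) ≤ T := by exact_mod_cast (by omega : 1 ≤ T)
  apply Real.le_sqrt_of_sq_le
  rw [mul_pow, Real.sq_sqrt (div_nonneg (by linarith) (by positivity)), mul_div_assoc']
  gcongr
  have : (1 + 1 / (2 * (T : ℝ) + 1)) = (2 * T + 2) / (2 * T + 1) := by field_simp; ring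
  rw [this, div_pow, div_mul_eq_mul_div, div_le_iff₀ (by positivity)]
  nlinarith

/-- Controls the factor of the vertex just added, whose degree is 1, or 2 if it made a loop. -/
theorem ascFactorial_one_add_le {K r b : ℕ} (hK : r + 1 ≤ K) (hb : b ≤ 1) :
    (1 + b).ascFactorial r ≤ K ^ r := by
  calc (1 + b).ascFactorial r = (b + 1).ascFactorial r := by rw [add_comm]
    _ ≤ (b + r) ^ r := Nat.ascFactorial_le_pow_add b r
    _ ≤ K ^ r := Nat.pow_le_pow_left (by omega) r

theorem one_add_sum_le_prod {ι : Type*} (s : Finset ι) (f : ι → ℝ) (hf : ∀ i ∈ s, 0 ≤ f i) :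
    1 + ∑ i ∈ s, f i ≤ ∏ i ∈ s, (1 + f i) := by
  classical
  induction s using Finset.induction_on with
  | empty => simp
  | insert a s ha ih =>
    rw [Finset.sum_insert ha, Finset.prod_insert ha]
    have h1 := hf a (Finset.mem_insert_self _ _)
    have h2 := ih fun i hi => hf i (Finset.mem_insert_of_mem hi)
    have h3 := Finset.sum_nonneg (s := s) fun i hi => hf i (Finset.mem_insert_of_mem hi)
    nlinarith

/-- The growth of mixed moments of the degrees, with weights `r`. -/
noncomputable def degreeGrowth (K T : ℕ) (r : ℕ → ℕ) : ℝ :=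
  ∏ v ∈ Finset.range T, (K * √((2 * T - 1) / (2 * v + 1))) ^ r v

theorem degreeGrowth_nonneg (K T : ℕ) (r : ℕ → ℕ) : 0 ≤ degreeGrowth K T r :=
  Finset.prod_nonneg fun _ _ => by positivity

/-- Bernoulli's inequality spreads the eigenvalue of the attachment step over the vertices as powers
of 1 + 1/(2T+1), and each is absorbed by the growth of a square root. The power of `K` pays for the
new vertex `T`. -/
theorem degreeGrowth_succ_ge (K T : ℕ) (r : ℕ → ℕ) :
    (K : ℝ) ^ r T * (1 + ∑ v ∈ Finset.range T, (r v : ℝ) / (2 * T + 1)) * degreeGrowth K T r ≤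
      degreeGrowth K (T + 1) r := by
  have hpos : 0 < (2 * (T : ℝ) + 1) := by positivity
  unfold degreeGrowth
  rw [Finset.prod_range_succ, mul_assoc, mul_comm]
  have h0 : (2 * ((T + 1 : ℕ) : ℝ) - 1) = 2 * T + 1 := by push_cast; ring
  rw [h0, div_self hpos.ne', Real.sqrt_one, mul_one]
  gcongr
  calc (1 + ∑ v ∈ Finset.range T, (r v : ℝ) / (2 * T + 1)) *
        ∏ v ∈ Finset.range T, (K * √((2 * T - 1) / (2 * v + 1))) ^ r v
      ≤ (∏ v ∈ Finset.range T, (1 + 1 / (2 * (T : ℝ) + 1)) ^ r v) *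
        ∏ v ∈ Finset.range T, (K * √((2 * T - 1) / (2 * v + 1))) ^ r v := by
        gcongr
        refine (one_add_sum_le_prod _ _ fun v _ => by positivity).trans ?_
        refine Finset.prod_le_prod (fun v _ => by positivity) fun v _ => ?_
        have := one_add_mul_le_pow (a := 1 / (2 * (T : ℝ) + 1))
          (by have : 0 ≤ 1 / (2 * (T : ℝ) + 1) := by positivity
              linarith) (r v)
        rwa [mul_one_div] at this
    _ ≤ _ := by
        rw [← Finset.prod_mul_distrib]
        refine Finset.prod_le_prod (fun v _ => by positivity) fun v hv => ?_
        rw [← mul_pow]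
        refine pow_le_pow_left₀ (by positivity) ?_ _
        calc _ = K * ((1 + 1 / (2 * (T : ℝ) + 1)) * √((2 * T - 1) / (2 * v + 1))) := by ring
          _ ≤ _ := by gcongr; exact one_add_inv_mul_sqrt_le (Finset.mem_range.1 hv)

theorem degreeGrowth_mono_succ (K T : ℕ) (r : ℕ → ℕ) :
    (K : ℝ) ^ r T * degreeGrowth K T r ≤ degreeGrowth K (T + 1) r := by
  refine le_trans ?_ (degreeGrowth_succ_ge K T r)
  gcongr
  · exact degreeGrowth_nonneg _ _ _
  refine le_mul_of_one_le_right (by positivity) (le_add_of_nonneg_right ?_)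
  exact Finset.sum_nonneg fun _ _ => by positivity

theorem degreeGrowth_update {K T y : ℕ} (hy : y < T) (r : ℕ → ℕ) :
    degreeGrowth K T (Function.update r y (r y + 1)) =
      K * √((2 * T - 1) / (2 * y + 1)) * degreeGrowth K T r := by
  have hi' := Finset.mem_range.2 hy
  unfold degreeGrowth
  rw [← Finset.mul_prod_erase _ _ hi', ← Finset.mul_prod_erase _ _ hi', Function.update_self,
    pow_succ', mul_assoc]
  congr 2
  refine Finset.prod_congr rfl fun v hv => ?_
  rw [Function.update_of_ne (Finset.ne_of_mem_erase hv)]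

/-- The factor by which prescribing the edge from `s` to `y` changes an expectation. -/
noncomputable def edgeFactor (K s y : ℕ) : ℝ := K / √((2 * s + 1) * (2 * y + 1))

theorem sqrt_div_le_edgeFactor {K T y : ℕ} :
    K * √((2 * T - 1) / (2 * y + 1)) / (2 * T + 1) ≤ edgeFactor K T y := by
  have hpos : 0 < (2 * (T : ℝ) + 1) := by positivity
  have hpos' : 0 < (2 * (y : ℝ) + 1) := by positivity
  unfold edgeFactor
  rw [mul_div_assoc, div_eq_mul_inv (K : ℝ)]
  gcongr
  rw [← Real.sqrt_inv]
  apply Real.le_sqrt_of_sq_le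
  rw [div_pow]
  rcases le_or_gt 0 ((2 * (T : ℝ) - 1) / (2 * y + 1)) with h | h
  · rw [Real.sq_sqrt h, div_le_iff₀ (by positivity), div_le_iff₀ hpos']
    field_simp
    linarith
  -- This occurs only for `T = 0`, where the square root of a negative number is 0.
  · rw [Real.sqrt_eq_zero_of_nonpos h.le]
    simp only [ne_eq, OfNat.ofNat_ne_zero, not_false_eq_true, zero_pow, zero_div]
    positivity

/-- Induction on time, with the rising factorials carried along so that the hypothesis is stable
when the latest edge is peeled off. If vertex `T` has a prescribed target, that target is earlier,
equal to `T` (a loop), or impossible; if not, only the eigenvalue appears. -/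
theorem attachExp_joint_moment_le (K : ℕ) (S : Finset ℕ) (f : ℕ → ℕ) (T : ℕ) (r : ℕ → ℕ)
    (hK : ∀ v, r v + (S.filter (· < T)).card + 1 ≤ K) :
    attachExp T (fun x =>
      (∏ s ∈ Finset.range T, if s ∈ S then (if x s = f s then (1 : ℝ) else 0) else 1) *
        ((∏ v ∈ Finset.range T, (1 + hits T x v).ascFactorial (r v) : ℕ) : ℝ)) ≤
    (∏ s ∈ Finset.range T, if s ∈ S then edgeFactor K s (f s) else 1) * degreeGrowth K T r := by
  induction T generalizing r with
  | zero => simp [attachExp, degreeGrowth]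
  | succ T ih =>
    have hpos : 0 < (2 * (T : ℝ) + 1) := by positivity
    set I : (ℕ → ℕ) → ℝ := fun x =>
      ∏ s ∈ Finset.range T, if s ∈ S then (if x s = f s then (1 : ℝ) else 0) else 1 with hI
    set B : ℝ := ∏ s ∈ Finset.range T, if s ∈ S then edgeFactor K s (f s) else 1 with hB
    have hI0 : ∀ x, 0 ≤ I x := fun x => Finset.prod_nonneg fun s _ => by split_ifs <;> norm_num
    have hB0 : 0 ≤ B := Finset.prod_nonneg fun s _ => by
      split_ifs
      · unfold edgeFactor; positivity
      · norm_num
    have hIu : ∀ x i, I (Function.update x T i) = I x := fun x i =>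
      Finset.prod_congr rfl fun s hs => by
        rw [Function.update_of_ne (Finset.mem_range.1 hs).ne]
    have hrT : r T + 1 ≤ K := by have := hK T; omega
    have hcard : (S.filter (· < T)).card ≤ (S.filter (· < T + 1)).card :=
      Finset.card_le_card fun s hs => by
        simp only [Finset.mem_filter] at hs ⊢
        exact ⟨hs.1, by omega⟩
    have hterm : ∀ x, IsAttachSeq T x → ∀ i,
        ((∏ v ∈ Finset.range (T + 1),
          (1 + hits (T + 1) (Function.update x T i) v).ascFactorial (r v) : ℕ) : ℝ) ≤
        (K : ℝ) ^ r T * ((∏ v ∈ Finset.range T,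
          (1 + hits T x v + if i = v then 1 else 0).ascFactorial (r v) : ℕ) : ℝ) := by
      intro x hx i
      rw [Finset.prod_range_succ, mul_comm]
      simp only [hits_succ_update, ← add_assoc]
      rw [hx.hits_eq_zero le_rfl, add_zero]
      have := ascFactorial_one_add_le (b := if i = T then 1 else 0) hrT (by split_ifs <;> simp)
      rw [Nat.cast_mul, ← Nat.cast_pow]
      gcongr
    rw [attachExp, Finset.prod_range_succ _ T]
    by_cases hTS : T ∈ S
    · rw [if_pos hTS]
      have hcard' : (S.filter (· < T)).card + 1 ≤ (S.filter (· < T + 1)).card := by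
        rw [← Finset.card_insert_of_notMem (a := T) (s := S.filter (· < T)) (by simp)]
        refine Finset.card_le_card fun s hs => ?_
        simp only [Finset.mem_insert, Finset.mem_filter] at hs ⊢
        rcases hs with rfl | hs
        · exact ⟨hTS, by omega⟩
        · exact ⟨hs.1, by omega⟩
      have hsimp : ∀ x, ∑ i ∈ Finset.range (T + 1), stepProb T x i *
          ((∏ s ∈ Finset.range (T + 1), if s ∈ S then
            (if Function.update x T i s = f s then (1 : ℝ) else 0) else 1) *
          ((∏ v ∈ Finset.range (T + 1),
            (1 + hits (T + 1) (Function.update x T i) v).ascFactorial (r v) : ℕ) : ℝ)) =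
          if f T < T + 1 then stepProb T x (f T) * (I x * ((∏ v ∈ Finset.range (T + 1),
            (1 + hits (T + 1) (Function.update x T (f T)) v).ascFactorial (r v) : ℕ) : ℝ))
          else 0 := by
        intro x
        have h0 := Finset.sum_ite_eq' (Finset.range (T + 1)) (f T) (fun i => stepProb T x i *
          (I x * ((∏ v ∈ Finset.range (T + 1),
            (1 + hits (T + 1) (Function.update x T i) v).ascFactorial (r v) : ℕ) : ℝ)))
        simp only [Finset.mem_range] at h0
        rw [← h0]
        refine Finset.sum_congr rfl fun i _ => ?_
        rw [Finset.prod_range_succ, if_pos hTS, Function.update_self]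
        have := hIu x i
        simp only [hI] at this ⊢
        rw [this]
        split_ifs <;> simp
      simp only [hsimp]
      rcases lt_trichotomy (f T) T with hlt | heq | hgt
      · simp only [if_pos (show f T < T + 1 by omega)]
        -- The prescribed edge raises the exponent at its target by one, but it also leaves the set
        -- of edges still to be treated, so the condition on `K` is preserved.
        have h1 := ih (Function.update r (f T) (r (f T) + 1)) fun v => by
          have h2 := hK v
          by_cases hv : v = f T
          · subst hv; rw [Function.update_self]; omega
          · rw [Function.update_of_ne hv]; omega
        rw [degreeGrowth_update hlt] at h1
        calc _ ≤ attachExp T (fun x => (K : ℝ) ^ r T / (2 * T + 1) * (I x *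
                ((∏ v ∈ Finset.range T, (1 + hits T x v).ascFactorial
                  (Function.update r (f T) (r (f T) + 1) v) : ℕ) : ℝ))) := by
              refine attachExp_mono fun x hx => ?_
              rw [← prod_ascFactorial_hit hlt (fun v => 1 + hits T x v) r]
              calc _ ≤ stepProb T x (f T) * (I x * ((K : ℝ) ^ r T * ((∏ v ∈ Finset.range T,
                    (1 + hits T x v + if f T = v then 1 else 0).ascFactorial (r v) : ℕ) : ℝ))) := by
                    have := hterm x hx (f T)
                    have h3 := hI0 x
                    have h4 := stepProb_nonneg T x (f T)
                    gcongr
                _ = _ := by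
                    unfold stepProb
                    push_cast
                    ring
          _ ≤ (K : ℝ) ^ r T / (2 * T + 1) *
                (B * (K * √((2 * T - 1) / (2 * f T + 1)) * degreeGrowth K T r)) := by
              rw [attachExp_const_mul]
              gcongr
          _ = B * (K * √((2 * T - 1) / (2 * f T + 1)) / (2 * T + 1)) *
                ((K : ℝ) ^ r T * degreeGrowth K T r) := by ring
          _ ≤ _ := by
              have := degreeGrowth_nonneg K T r
              gcongr
              · unfold edgeFactor; positivity
              · exact sqrt_div_le_edgeFactor
              · exact degreeGrowth_mono_succ K T r
      · simp only [if_pos (show f T < T + 1 by omega)]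
        have h1 := ih r fun v => by have h2 := hK v; omega
        calc _ ≤ attachExp T (fun x => (K : ℝ) ^ r T / (2 * T + 1) * (I x *
                ((∏ v ∈ Finset.range T, (1 + hits T x v).ascFactorial (r v) : ℕ) : ℝ))) := by
              refine attachExp_mono fun x hx => ?_
              calc _ ≤ stepProb T x (f T) * (I x * ((K : ℝ) ^ r T * ((∏ v ∈ Finset.range T,
                    (1 + hits T x v + if f T = v then 1 else 0).ascFactorial (r v) : ℕ) : ℝ))) := by
                    have := hterm x hx (f T)
                    have h3 := hI0 x
                    have h4 := stepProb_nonneg T x (f T)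
                    gcongr
                _ = _ := by
                    rw [prod_ascFactorial_miss heq.ge (fun v => 1 + hits T x v), heq]
                    unfold stepProb
                    rw [hx.hits_eq_zero le_rfl]
                    push_cast
                    ring
          _ ≤ (K : ℝ) ^ r T / (2 * T + 1) * (B * degreeGrowth K T r) := by
              rw [attachExp_const_mul]
              gcongr
          _ = B * (1 / (2 * T + 1)) * ((K : ℝ) ^ r T * degreeGrowth K T r) := by ring
          _ ≤ _ := by
              have := degreeGrowth_nonneg K T r
              have hK1 : (1 : ℝ) ≤ K := by exact_mod_cast (by omega : 1 ≤ K)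
              gcongr
              · unfold edgeFactor; positivity
              · unfold edgeFactor
                rw [heq, Real.sqrt_mul_self hpos.le]
                gcongr
              · exact degreeGrowth_mono_succ K T r
      · simp only [if_neg (show ¬ f T < T + 1 by omega)]
        rw [attachExp_const]
        refine mul_nonneg (mul_nonneg hB0 ?_) (degreeGrowth_nonneg _ _ _)
        unfold edgeFactor; positivity
    · rw [if_neg hTS, mul_one]
      have h1 := ih r fun v => by have h2 := hK v; omega
      calc _ ≤ attachExp T (fun x => (K : ℝ) ^ r T *
                (1 + ∑ v ∈ Finset.range T, (r v : ℝ) / (2 * T + 1)) * (I x *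
                ((∏ v ∈ Finset.range T, (1 + hits T x v).ascFactorial (r v) : ℕ) : ℝ))) := by
            refine attachExp_mono fun x hx => ?_
            calc _ ≤ ∑ i ∈ Finset.range (T + 1), stepProb T x i *
                  (I x * ((K : ℝ) ^ r T * ((∏ v ∈ Finset.range T,
                    (1 + hits T x v + if i = v then 1 else 0).ascFactorial (r v) : ℕ) : ℝ))) := by
                  refine Finset.sum_le_sum fun i _ => ?_
                  rw [Finset.prod_range_succ _ T, if_neg hTS, mul_one]
                  have h2 := hIu x i
                  simp only [hI] at h2
                  rw [h2]
                  have := hterm x hx i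
                  have h3 := hI0 x
                  have h4 := stepProb_nonneg T x i
                  gcongr
              _ = _ := by
                  have := sum_stepProb_mul_prod_ascFactorial hx r
                  rw [show ∀ a b c d : ℝ, a * b * (c * d) = c * a * (b * d) by intros; ring, ← this,
                    Finset.mul_sum]
                  exact Finset.sum_congr rfl fun i _ => by ring
        _ ≤ (K : ℝ) ^ r T * (1 + ∑ v ∈ Finset.range T, (r v : ℝ) / (2 * T + 1)) *
              (B * degreeGrowth K T r) := by
            rw [attachExp_const_mul]
            gcongr
        _ = B * ((K : ℝ) ^ r T * (1 + ∑ v ∈ Finset.range T, (r v : ℝ) / (2 * T + 1)) *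
              degreeGrowth K T r) := by ring
        _ ≤ _ := by
            gcongr
            exact degreeGrowth_succ_ge K T r

/-- The weight of a potential edge between the vertices `i` and `j`. -/
noncomputable def edgeWeight (i j : ℕ) : ℝ := (√(i + 1))⁻¹ * (√(j + 1))⁻¹

theorem edgeWeight_nonneg (i j : ℕ) : 0 ≤ edgeWeight i j := by unfold edgeWeight; positivity

theorem edgeFactor_le (K s y : ℕ) : edgeFactor K s y ≤ K * edgeWeight s y := by
  unfold edgeFactor edgeWeight
  rw [← mul_inv, ← Real.sqrt_mul (by positivity), div_eq_mul_inv]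
  gcongr <;> linarith

/-- The probability that all edges of a given finite set are present. -/
theorem attachExp_prod_indicator_le (T : ℕ) (P : Finset (ℕ × ℕ)) (hP : ∀ e ∈ P, e.1 < T) :
    attachExp T (fun x => ∏ e ∈ P, if x e.1 = e.2 then (1 : ℝ) else 0) ≤
      ((P.card + 1 : ℕ) : ℝ) ^ P.card * ∏ e ∈ P, edgeWeight e.1 e.2 := by
  classical
  have hR : 0 ≤ ((P.card + 1 : ℕ) : ℝ) ^ P.card * ∏ e ∈ P, edgeWeight e.1 e.2 :=
    mul_nonneg (by positivity) (Finset.prod_nonneg fun e _ => edgeWeight_nonneg _ _)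
  by_cases hinj : Set.InjOn Prod.fst (P : Set (ℕ × ℕ))
  · set S := P.image Prod.fst with hS
    have hex : ∀ s, ∃ y, s ∈ S → (s, y) ∈ P := by
      intro s
      by_cases hs : s ∈ S
      · obtain ⟨e, he, rfl⟩ := Finset.mem_image.1 hs
        exact ⟨e.2, fun _ => he⟩
      · exact ⟨0, fun h => absurd h hs⟩
    choose f hf using hex
    have hf2 : ∀ e ∈ P, f e.1 = e.2 := by
      intro e he
      have h1 := hf e.1 (Finset.mem_image_of_mem _ he)
      have := hinj h1 he rfl
      exact congrArg Prod.snd this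
    have hprod : ∀ g : ℕ → ℕ → ℝ,
        ∏ s ∈ Finset.range T, (if s ∈ S then g s (f s) else 1) = ∏ e ∈ P, g e.1 e.2 := by
      intro g
      rw [← Finset.prod_filter, show (Finset.range T).filter (· ∈ S) = S by
        ext s
        simp only [Finset.mem_filter, Finset.mem_range, and_iff_right_iff_imp]
        intro hs
        obtain ⟨e, he, rfl⟩ := Finset.mem_image.1 hs
        exact hP e he, hS, Finset.prod_image hinj]
      exact Finset.prod_congr rfl fun e he => by rw [hf2 e he]
    have h := attachExp_joint_moment_le (P.card + 1) S f T (fun _ => 0) fun v => by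
      have := (Finset.card_filter_le S (· < T)).trans Finset.card_image_le
      omega
    simp only [Nat.ascFactorial_zero, Finset.prod_const_one, Nat.cast_one, mul_one, degreeGrowth,
      pow_zero] at h
    rw [hprod] at h
    have h2 : ∀ x : ℕ → ℕ, ∏ e ∈ P, (if x e.1 = e.2 then (1 : ℝ) else 0) =
      ∏ s ∈ Finset.range T, if s ∈ S then (if x s = f s then (1 : ℝ) else 0) else 1 :=
      fun x => (hprod fun s y => if x s = y then 1 else 0).symm
    simp only [h2]
    refine h.trans ?_
    rw [← Finset.prod_const, ← Finset.prod_mul_distrib]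
    refine Finset.prod_le_prod (fun e _ => ?_) fun e _ => edgeFactor_le _ _ _
    unfold edgeFactor; positivity
  -- Two prescribed edges with one source and different targets exclude each other, so the
  -- expectation is zero.
  · refine le_trans (le_of_eq ?_) hR
    refine (attachExp_congr fun x _ => ?_).trans (attachExp_const T 0)
    simp only [Set.InjOn, not_forall] at hinj
    obtain ⟨e, he, e', he', h1, h2⟩ := hinj
    by_cases hx : x e.1 = e.2
    · refine Finset.prod_eq_zero (i := e') he' (if_neg fun h => h2 ?_)
      exact Prod.ext h1 (by rw [← hx, h1, h])
    · exact Finset.prod_eq_zero (i := e) he (if_neg hx)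

/-! ### Edge counts between blocks -/

/-- The vertices merged into the vertex `i`. -/
def block (m i : ℕ) : Finset ℕ := Finset.Ico (i * m) ((i + 1) * m)

/-- The number of edges sent from the block `i` to the block `j`. -/
def edgeCount (m : ℕ) (x : ℕ → ℕ) (i j : ℕ) : ℕ := ((block m i).filter fun s => x s ∈ block m j).card

theorem card_block (m i : ℕ) : (block m i).card = m := by
  simp [block, add_mul]

theorem mem_block {m i s : ℕ} (hm : 0 < m) : s ∈ block m i ↔ s / m = i := by
  rw [block, Finset.mem_Ico, Nat.div_eq_iff hm, add_mul, one_mul]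
  omega

theorem le_of_mem_block {m i s : ℕ} (hm : 1 ≤ m) (h : s ∈ block m i) : i ≤ s := by
  have := (Finset.mem_Ico.1 h).1
  nlinarith

theorem edgeCount_le (m : ℕ) (x : ℕ → ℕ) (i j : ℕ) : edgeCount m x i j ≤ m :=
  (Finset.card_filter_le _ _).trans (card_block m i).le

theorem edgeCount_eq_sum (m : ℕ) (x : ℕ → ℕ) (i j : ℕ) :
    (edgeCount m x i j : ℝ) =
      ∑ z ∈ block m i ×ˢ block m j, if x z.1 = z.2 then (1 : ℝ) else 0 := by
  rw [Finset.sum_product, edgeCount, Finset.card_filter]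
  push_cast
  exact Finset.sum_congr rfl fun s _ => by rw [Finset.sum_ite_eq]

theorem edgeWeight_le_of_mem_block {m i j s y : ℕ} (hm : 1 ≤ m) (hs : s ∈ block m i)
    (hy : y ∈ block m j) : edgeWeight s y ≤ edgeWeight i j := by
  have h1 : (i : ℝ) ≤ s := by exact_mod_cast le_of_mem_block hm hs
  have h2 : (j : ℝ) ≤ y := by exact_mod_cast le_of_mem_block hm hy
  unfold edgeWeight
  gcongr

theorem attachExp_prod_indicator_le' {m n : ℕ} (hm : 1 ≤ m) {ι : Type*} (E : Finset ι)
    (e : ι → ℕ × ℕ) (φ : ι → ℕ × ℕ) (hφ : Set.InjOn φ E)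
    (hmem : ∀ a ∈ E, φ a ∈ block m (e a).1 ×ˢ block m (e a).2) (hn : ∀ a ∈ E, (e a).1 < n) :
    attachExp (n * m) (fun x => ∏ a ∈ E, if x (φ a).1 = (φ a).2 then (1 : ℝ) else 0) ≤
      ((E.card + 1 : ℕ) : ℝ) ^ E.card * ∏ a ∈ E, edgeWeight (e a).1 (e a).2 := by
  classical
  have h := attachExp_prod_indicator_le (n * m) (E.image φ) fun z hz => by
    obtain ⟨a, ha, rfl⟩ := Finset.mem_image.1 hz
    have h1 := (Finset.mem_Ico.1 (Finset.mem_product.1 (hmem a ha)).1).2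
    exact h1.trans_le (Nat.mul_le_mul_right m (hn a ha))
  rw [Finset.card_image_of_injOn hφ, Finset.prod_image hφ] at h
  simp only [Finset.prod_image hφ] at h
  refine h.trans ?_
  gcongr with a ha
  · exact fun a _ => edgeWeight_nonneg _ _
  · have := Finset.mem_product.1 (hmem a ha)
    exact edgeWeight_le_of_mem_block hm this.1 this.2

/-- Expanding the product chooses one edge of the unmerged graph for each pair of blocks, in at most
m² ways per pair; different pairs of blocks give different edges because blocks are disjoint. -/
theorem attachExp_prod_edgeCount_le {m n : ℕ} (hm : 1 ≤ m) (E : Finset (ℕ × ℕ))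
    (hn : ∀ e ∈ E, e.1 < n) :
    attachExp (n * m) (fun x => ∏ e ∈ E, (edgeCount m x e.1 e.2 : ℝ)) ≤
      ((m * m * (E.card + 1) : ℕ) : ℝ) ^ E.card * ∏ e ∈ E, edgeWeight e.1 e.2 := by
  classical
  simp only [edgeCount_eq_sum]
  have h1 : ∀ x : ℕ → ℕ, ∏ e ∈ E, (∑ z ∈ block m e.1 ×ˢ block m e.2,
      if x z.1 = z.2 then (1 : ℝ) else 0) =
      ∑ φ ∈ E.pi (fun e => block m e.1 ×ˢ block m e.2), ∏ e ∈ E.attach,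
        if x (φ e.1 e.2).1 = (φ e.1 e.2).2 then (1 : ℝ) else 0 := fun x => Finset.prod_sum _ _ _
  simp only [h1]
  rw [attachExp_sum]
  have h2 : ∀ φ ∈ E.pi (fun e => block m e.1 ×ˢ block m e.2),
      attachExp (n * m) (fun x => ∏ e ∈ E.attach,
        if x (φ e.1 e.2).1 = (φ e.1 e.2).2 then (1 : ℝ) else 0) ≤
      ((E.card + 1 : ℕ) : ℝ) ^ E.card * ∏ e ∈ E, edgeWeight e.1 e.2 := by
    intro φ hφ
    rw [Finset.mem_pi] at hφ
    have h3 := attachExp_prod_indicator_le' (n := n) hm E.attach (fun e => e.1)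
      (fun e => φ e.1 e.2) ?_ (fun a _ => hφ a.1 a.2) (fun a _ => hn a.1 a.2)
    · rwa [Finset.card_attach, Finset.prod_attach E fun e => edgeWeight e.1 e.2] at h3
    · intro a _ b _ hab
      simp only at hab
      have ha := Finset.mem_product.1 (hφ a.1 a.2)
      have hb := Finset.mem_product.1 (hφ b.1 b.2)
      rw [← hab, mem_block hm, mem_block hm] at hb
      rw [mem_block hm, mem_block hm] at ha
      exact Subtype.ext (Prod.ext (ha.1.symm.trans hb.1) (ha.2.symm.trans hb.2))
  refine (Finset.sum_le_card_nsmul _ _ _ h2).trans (le_of_eq ?_)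
  rw [Finset.card_pi, nsmul_eq_mul]
  simp only [Finset.card_product, card_block, Finset.prod_const]
  push_cast
  rw [mul_pow (_ * _)]
  ring

/-! ### Closed walks -/

/-- The edge joining `i` and `j`, written with the larger end first. -/
def orderedPair (i j : ℕ) : ℕ × ℕ := (max i j, min i j)

theorem orderedPair_comm (i j : ℕ) : orderedPair i j = orderedPair j i := by
  simp [orderedPair, max_comm, min_comm]

/-- The edges, without multiplicity, of a closed walk. -/
def walkEdges {q : ℕ} (w : Fin (q + 1) → ℕ) : Finset (ℕ × ℕ) :=
  Finset.univ.image fun l => orderedPair (w l) (w (l + 1))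

/-- The degree of `v` in a simple graph with loops given by ordered edges. -/
def edgesDegree (E : Finset (ℕ × ℕ)) (v : ℕ) : ℕ :=
  (E.filter fun e => e.1 = v).card + (E.filter fun e => e.2 = v).card

theorem orderedPair_mem_walkEdges {q : ℕ} (w : Fin (q + 1) → ℕ) (l : Fin (q + 1)) :
    orderedPair (w l) (w (l + 1)) ∈ walkEdges w :=
  Finset.mem_image_of_mem _ (Finset.mem_univ l)

theorem orderedPair_sub_mem_walkEdges {q : ℕ} (w : Fin (q + 1) → ℕ) (l : Fin (q + 1)) :
    orderedPair (w l) (w (l - 1)) ∈ walkEdges w := by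
  have := orderedPair_mem_walkEdges w (l - 1)
  rwa [sub_add_cancel, orderedPair_comm] at this

theorem edgesDegree_add_le {E : Finset (ℕ × ℕ)} {c : ℕ} {N₁ N₂ : Finset ℕ}
    (h₁ : ∀ u ∈ N₁, (c, u) ∈ E) (h₂ : ∀ u ∈ N₂, (u, c) ∈ E) :
    N₁.card + N₂.card ≤ edgesDegree E c := by
  unfold edgesDegree
  gcongr
  · refine Finset.card_le_card_of_injOn (fun u => (c, u)) (fun u hu => ?_) fun a _ b _ h => ?_
    · simpa using h₁ u hu
    · simpa using h
  · refine Finset.card_le_card_of_injOn (fun u => (u, c)) (fun u hu => ?_) fun a _ b _ h => ?_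
    · simpa using h₂ u hu
    · simpa using h

/-- Smaller neighbours of `c` are second ends and larger ones first ends, so each is counted once,
while a loop is counted at both ends. -/
theorem card_neighbors_le {E : Finset (ℕ × ℕ)} {c : ℕ} {N : Finset ℕ}
    (hN : ∀ u ∈ N, u ≠ c ∧ orderedPair u c ∈ E) :
    N.card + (if (c, c) ∈ E then 2 else 0) ≤ edgesDegree E c := by
  have hsplit : (N.filter (· < c)).card + (N.filter (c < ·)).card = N.card := by
    rw [← Finset.card_filter_add_card_filter_not (s := N) (· < c)]
    congr 2
    refine Finset.filter_congr fun u hu => ?_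
    have := (hN u hu).1
    omega
  have h₁ : ∀ u ∈ N.filter (· < c), (c, u) ∈ E := fun u hu => by
    rw [Finset.mem_filter] at hu
    have := (hN u hu.1).2
    rwa [orderedPair, max_eq_right hu.2.le, min_eq_left hu.2.le] at this
  have h₂ : ∀ u ∈ N.filter (c < ·), (u, c) ∈ E := fun u hu => by
    rw [Finset.mem_filter] at hu
    have := (hN u hu.1).2
    rwa [orderedPair, max_eq_left hu.2.le, min_eq_right hu.2.le] at this
  split_ifs with hc
  · have := edgesDegree_add_le (N₁ := insert c (N.filter (· < c)))
      (N₂ := insert c (N.filter (c < ·))) (c := c) (E := E) (fun u hu => by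
        rcases Finset.mem_insert.1 hu with rfl | hu
        · exact hc
        · exact h₁ u hu) (fun u hu => by
        rcases Finset.mem_insert.1 hu with rfl | hu
        · exact hc
        · exact h₂ u hu)
    rw [Finset.card_insert_of_notMem (by simp), Finset.card_insert_of_notMem (by simp)] at this
    omega
  · have := edgesDegree_add_le h₁ h₂
    omega

theorem eq_of_edgesDegree_eq_one {E : Finset (ℕ × ℕ)} {v a b : ℕ} (hv : edgesDegree E v = 1)
    (ha : orderedPair v a ∈ E) (hb : orderedPair v b ∈ E) : a = b ∧ a ≠ v := by
  have hne : ∀ u, orderedPair v u ∈ E → u ≠ v := by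
    rintro u hu rfl
    have := card_neighbors_le (E := E) (c := u) (N := ∅) (by simp)
    rw [if_pos (by simpa [orderedPair] using hu)] at this
    omega
  refine ⟨?_, hne a ha⟩
  by_contra hab
  have := card_neighbors_le (E := E) (c := v) (N := {a, b}) (by
    intro u hu
    simp only [Finset.mem_insert, Finset.mem_singleton] at hu
    rcases hu with rfl | rfl
    · exact ⟨hne _ ha, by rwa [orderedPair_comm]⟩
    · exact ⟨hne _ hb, by rwa [orderedPair_comm]⟩)
  rw [Finset.card_pair hab] at this
  omega

theorem edgesDegree_pos {q : ℕ} (w : Fin (q + 1) → ℕ) (l : Fin (q + 1)) :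
    0 < edgesDegree (walkEdges w) (w l) := by
  have h := orderedPair_mem_walkEdges w l
  unfold edgesDegree
  rcases le_total (w l) (w (l + 1)) with hle | hle
  · rw [orderedPair, max_eq_right hle, min_eq_left hle] at h
    have := Finset.card_pos.2 ⟨_, (Finset.mem_filter (p := fun e => e.2 = w l)).2 ⟨h, rfl⟩⟩
    omega
  · rw [orderedPair, max_eq_left hle, min_eq_right hle] at h
    have := Finset.card_pos.2 ⟨_, (Finset.mem_filter (p := fun e => e.1 = w l)).2 ⟨h, rfl⟩⟩
    omega

/-- Edge weights split into vertex weights, so regrouping by vertices turns incidence into degree.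
-/
theorem prod_edgeWeight_walkEdges {q : ℕ} (w : Fin (q + 1) → ℕ) :
    ∏ e ∈ walkEdges w, edgeWeight e.1 e.2 =
      ∏ v ∈ Finset.univ.image w, (√((v : ℝ) + 1))⁻¹ ^ edgesDegree (walkEdges w) v := by
  have hmem : ∀ e ∈ walkEdges w, e.1 ∈ Finset.univ.image w ∧ e.2 ∈ Finset.univ.image w := by
    intro e he
    obtain ⟨l, -, rfl⟩ := Finset.mem_image.1 he
    rcases le_total (w l) (w (l + 1)) with hle | hle <;> simp [orderedPair, hle]
  unfold edgeWeight edgesDegree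
  simp only [pow_add]
  rw [Finset.prod_mul_distrib, Finset.prod_mul_distrib]
  congr 1
  · rw [← Finset.prod_fiberwise_of_maps_to (fun e he => (hmem e he).1)]
    refine Finset.prod_congr rfl fun v _ => ?_
    rw [← Finset.prod_const]
    exact Finset.prod_congr rfl fun e he => by rw [(Finset.mem_filter.1 he).2]
  · rw [← Finset.prod_fiberwise_of_maps_to (fun e he => (hmem e he).2)]
    refine Finset.prod_congr rfl fun v _ => ?_
    rw [← Finset.prod_const]
    exact Finset.prod_congr rfl fun e he => by rw [(Finset.mem_filter.1 he).2]

/-- The expected number of traversals of a closed walk, up to a constant factor. -/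
theorem attachExp_prod_walk_le {m n q : ℕ} (hm : 1 ≤ m) (w : Fin (q + 1) → ℕ) (hw : ∀ l, w l < n) :
    attachExp (n * m) (fun x => ∏ l, (edgeCount m x (max (w l) (w (l + 1)))
      (min (w l) (w (l + 1))) : ℝ)) ≤
      ((m ^ 3 * (q + 2) : ℕ) : ℝ) ^ (q + 1) * ∏ e ∈ walkEdges w, edgeWeight e.1 e.2 := by
  have hcard : (walkEdges w).card ≤ q + 1 := Finset.card_image_le.trans (by simp)
  have h1 := attachExp_prod_edgeCount_le (n := n) hm (walkEdges w) fun e he => by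
    obtain ⟨l, -, rfl⟩ := Finset.mem_image.1 he
    exact max_lt (hw _) (hw _)
  -- Among the traversals of one edge, one factor is kept and the others are bounded by `m`.
  have h2 : ∀ x : ℕ → ℕ, ∏ l, (edgeCount m x (max (w l) (w (l + 1))) (min (w l) (w (l + 1))) : ℝ) ≤
      (m : ℝ) ^ (q + 1) * ∏ e ∈ walkEdges w, (edgeCount m x e.1 e.2 : ℝ) := by
    intro x
    have h3 := Finset.prod_fiberwise_of_maps_to (s := Finset.univ) (t := walkEdges w)
      (g := fun l => orderedPair (w l) (w (l + 1))) (fun l _ => orderedPair_mem_walkEdges w l)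
      (fun l => edgeCount m x (max (w l) (w (l + 1))) (min (w l) (w (l + 1))))
    have h4 := Finset.prod_fiberwise_of_maps_to (s := Finset.univ) (t := walkEdges w)
      (g := fun l => orderedPair (w l) (w (l + 1))) (fun l _ => orderedPair_mem_walkEdges w l)
      (fun _ => m)
    rw [Finset.prod_const, Finset.card_univ, Fintype.card_fin] at h4
    rw [← Nat.cast_prod, ← Nat.cast_prod, ← Nat.cast_pow, ← Nat.cast_mul, Nat.cast_le, ← h3, ← h4,
      ← Finset.prod_mul_distrib]
    refine Finset.prod_le_prod' fun e he => ?_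
    obtain ⟨l, -, hl⟩ := Finset.mem_image.1 he
    rw [← Finset.mul_prod_erase _ _ (Finset.mem_filter.2 ⟨Finset.mem_univ l, hl⟩), mul_comm,
      ← Finset.mul_prod_erase (Finset.univ.filter _) (fun _ => m)
        (Finset.mem_filter.2 ⟨Finset.mem_univ l, hl⟩)]
    refine Nat.mul_le_mul ?_ (le_of_eq (by rw [← hl]; rfl))
    refine (Finset.prod_le_prod' fun l' _ => edgeCount_le _ _ _ _).trans ?_
    exact Nat.le_mul_of_pos_left _ hm
  refine (attachExp_mono fun x _ => h2 x).trans ?_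
  rw [attachExp_const_mul]
  have h5 : 0 ≤ ∏ e ∈ walkEdges w, edgeWeight e.1 e.2 :=
    Finset.prod_nonneg fun _ _ => edgeWeight_nonneg _ _
  calc _ ≤ (m : ℝ) ^ (q + 1) * (((m * m * (q + 2) : ℕ) : ℝ) ^ (q + 1) *
        ∏ e ∈ walkEdges w, edgeWeight e.1 e.2) := by
        gcongr
        refine h1.trans ?_
        gcongr
        calc ((m * m * ((walkEdges w).card + 1) : ℕ) : ℝ) ^ (walkEdges w).card
            ≤ ((m * m * (q + 2) : ℕ) : ℝ) ^ (walkEdges w).card := by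
              refine pow_le_pow_left₀ (by positivity) ?_ _
              exact_mod_cast Nat.mul_le_mul_left (m * m) (by omega)
          _ ≤ _ := by
              gcongr
              · have : 1 ≤ m * m * (q + 2) := Nat.one_le_iff_ne_zero.2 (by positivity)
                exact_mod_cast this
    _ = _ := by
        rw [← mul_assoc, ← mul_pow, ← Nat.cast_mul]
        congr 3
        ring

/-! ### Summing edge weights over closed walks -/

/-- The sum of the `d`-th powers of the vertex weights. -/
noncomputable def vertexSum (n d : ℕ) : ℝ := ∑ i ∈ Finset.range n, (√((i : ℝ) + 1))⁻¹ ^ d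

theorem inv_sqrt_le_one (i : ℕ) : (√((i : ℝ) + 1))⁻¹ ≤ 1 :=
  inv_le_one_of_one_le₀ (Real.one_le_sqrt.2 (by linarith [Nat.cast_nonneg (α := ℝ) i]))

theorem vertexSum_nonneg (n d : ℕ) : 0 ≤ vertexSum n d :=
  Finset.sum_nonneg fun _ _ => by positivity

/-- The coincidence pattern of a walk, together with the truncated degrees along it. -/
noncomputable def walkType {q : ℕ} (w : Fin (q + 1) → ℕ) :
    (Fin (q + 1) → Fin (q + 1)) × (Fin (q + 1) → Fin 4) :=
  (fun l => Function.invFun w (w l), fun l => ⟨min (edgesDegree (walkEdges w) (w l)) 3, by omega⟩)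

/-- The positions fixed by `τ.1` represent the distinct vertices, and a walk of this type is
determined by its values there. Dropping the requirement that these values differ lets the sum
factorise. -/
theorem sum_walks_le_of_walkType {q n : ℕ} (W : Finset (Fin (q + 1) → ℕ))
    (hW : ∀ w ∈ W, ∀ l, w l < n) (τ : (Fin (q + 1) → Fin (q + 1)) × (Fin (q + 1) → Fin 4))
    (hτ : ∀ w ∈ W, walkType w = τ) :
    ∑ w ∈ W, ∏ e ∈ walkEdges w, edgeWeight e.1 e.2 ≤
      ∏ l ∈ Finset.univ.filter (fun l => τ.1 l = l), vertexSum n (τ.2 l) := by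
  set R := Finset.univ.filter (fun l => τ.1 l = l) with hR
  have hg : ∀ w ∈ W, ∀ l, Function.invFun w (w l) = τ.1 l := fun w hw l => by
    rw [← hτ w hw]; rfl
  have hwg : ∀ w ∈ W, ∀ l, w (τ.1 l) = w l := fun w hw l => by
    rw [← hg w hw]; exact Function.invFun_eq ⟨l, rfl⟩
  have hgR : ∀ w ∈ W, ∀ l, τ.1 l ∈ R := fun w hw l => by
    rw [hR, Finset.mem_filter]
    exact ⟨Finset.mem_univ _, by rw [← hg w hw, hwg w hw, hg w hw]⟩
  have h1 : ∀ w ∈ W, ∏ e ∈ walkEdges w, edgeWeight e.1 e.2 ≤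
      ∏ l ∈ R.attach, (√((w l.1 : ℝ) + 1))⁻¹ ^ (τ.2 l.1 : ℕ) := by
    intro w hw
    have himg : Finset.univ.image w = R.image w := by
      ext v
      simp only [Finset.mem_image, Finset.mem_univ, true_and]
      constructor
      · rintro ⟨l, rfl⟩
        exact ⟨τ.1 l, hgR w hw l, hwg w hw l⟩
      · rintro ⟨l, -, rfl⟩
        exact ⟨l, rfl⟩
    have hinj : Set.InjOn w R := by
      intro a ha b hb hab
      rw [hR, Finset.coe_filter, Set.mem_ofPred_eq] at ha hb
      rw [← ha.2, ← hb.2, ← hg w hw, ← hg w hw, hab]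
    rw [prod_edgeWeight_walkEdges, himg, Finset.prod_image hinj,
      Finset.prod_attach R fun l => (√((w l : ℝ) + 1))⁻¹ ^ (τ.2 l : ℕ)]
    refine Finset.prod_le_prod (fun _ _ => by positivity) fun l _ => ?_
    refine pow_le_pow_of_le_one (by positivity) (inv_sqrt_le_one _) ?_
    rw [← hτ w hw]
    exact min_le_left _ _
  refine (Finset.sum_le_sum h1).trans ?_
  unfold vertexSum
  rw [Finset.prod_sum, ← Finset.sum_image (s := W)
    (f := fun p : (a : Fin (q + 1)) → a ∈ R → ℕ => ∏ l ∈ R.attach,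
      (√((p l.1 l.2 : ℝ) + 1))⁻¹ ^ (τ.2 l.1 : ℕ)) (g := fun w l _ => w l)]
  · refine Finset.sum_le_sum_of_subset_of_nonneg ?_ fun _ _ _ =>
      Finset.prod_nonneg fun _ _ => by positivity
    intro p hp
    obtain ⟨w, hw, rfl⟩ := Finset.mem_image.1 hp
    exact Finset.mem_pi.2 fun l _ => Finset.mem_range.2 (hW w hw l)
  · intro w hw w' hw' h
    ext l
    have := congrFun (congrFun h (τ.1 l)) (hgR w hw l)
    simp only at this
    rw [← hwg w hw, this, hwg w' hw']

/-- The number of walk types. -/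
@[irreducible]
def numWalkTypes (q : ℕ) : ℕ :=
  Fintype.card ((Fin (q + 1) → Fin (q + 1)) × (Fin (q + 1) → Fin 4))

/-- The number of types does not depend on `n`, so a bound uniform over individual walks is enough.
-/
theorem sum_walks_le {q n : ℕ} (W : Finset (Fin (q + 1) → ℕ)) (hW : ∀ w ∈ W, ∀ l, w l < n)
    {B : ℝ} (hB0 : 0 ≤ B)
    (hB : ∀ w ∈ W, ∏ v ∈ Finset.univ.image w,
      vertexSum n (min (edgesDegree (walkEdges w) v) 3) ≤ B) :
    ∑ w ∈ W, ∏ e ∈ walkEdges w, edgeWeight e.1 e.2 ≤ numWalkTypes q * B := by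
  classical
  rw [← Finset.sum_fiberwise W walkType]
  refine (Finset.sum_le_card_nsmul Finset.univ _ B fun τ _ => ?_).trans_eq (by
    rw [nsmul_eq_mul, Finset.card_univ, numWalkTypes])
  rcases (W.filter fun w => walkType w = τ).eq_empty_or_nonempty with h | ⟨w, hw⟩
  · rw [h, Finset.sum_empty]
    exact hB0
  refine (sum_walks_le_of_walkType _ (fun w hw => hW w (Finset.mem_filter.1 hw).1) τ
    fun w hw => (Finset.mem_filter.1 hw).2).trans ?_
  obtain ⟨hwW, rfl⟩ := Finset.mem_filter.1 hw
  refine le_trans (le_of_eq ?_) (hB w hwW)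
  have hwg : ∀ l, w (Function.invFun w (w l)) = w l := fun l => Function.invFun_eq ⟨l, rfl⟩
  have himg : Finset.univ.image w =
      (Finset.univ.filter fun l => (walkType w).1 l = l).image w := by
    ext v
    simp only [Finset.mem_image, Finset.mem_univ, true_and, Finset.mem_filter]
    constructor
    · rintro ⟨l, rfl⟩
      exact ⟨Function.invFun w (w l), by simp only [walkType, hwg], hwg l⟩
    · rintro ⟨l, -, rfl⟩
      exact ⟨l, rfl⟩
  rw [himg, Finset.prod_image]
  · rfl
  · intro a ha b hb hab
    rw [Finset.coe_filter, Set.mem_ofPred_eq] at ha hb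
    rw [← ha.2, ← hb.2]
    simp only [walkType, hab]

/-! ### Leaves of closed walks -/

/-- The vertices of degree one on a closed walk. -/
def walkLeaves {q : ℕ} (w : Fin (q + 1) → ℕ) : Finset ℕ :=
  (Finset.univ.image w).filter fun v => edgesDegree (walkEdges w) v = 1

/-- A leaf has a single neighbour, so every visit to it is entered from and left to that same
vertex. -/
theorem neighbors_of_leaf {q : ℕ} {w : Fin (q + 1) → ℕ} {l : Fin (q + 1)}
    (hl : edgesDegree (walkEdges w) (w l) = 1) {l' : Fin (q + 1)} (h : w l' = w l) :
    w (l' + 1) = w (l - 1) ∧ w (l' + 1) ≠ w l := by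
  have h1 := orderedPair_mem_walkEdges w l'
  rw [h] at h1
  exact eq_of_edgesDegree_eq_one hl h1 (orderedPair_sub_mem_walkEdges w l)

-- From two consecutive leaves the walk can only alternate between them. This is impossible in
-- length 3 by parity; longer walks have half-length at least 2, which is what two vertices cost.
open Fin.CommRing in
theorem card_image_of_adjacent_leaves {q : ℕ} (hq : 2 ≤ q) {w : Fin (q + 1) → ℕ} {l : Fin (q + 1)}
    (h1 : edgesDegree (walkEdges w) (w l) = 1)
    (h2 : edgesDegree (walkEdges w) (w (l + 1)) = 1) :
    (Finset.univ.image w).card ≤ 2 ∧ 3 ≤ q := by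
  have ha := neighbors_of_leaf h1 rfl
  have hb := neighbors_of_leaf h2 rfl
  rw [add_sub_cancel_right] at hb
  have hall : ∀ j : ℕ, w (l + (j : Fin (q + 1))) = w l ∨ w (l + (j : Fin (q + 1))) = w (l + 1) := by
    intro j
    induction j with
    | zero => left; simp
    | succ j ih =>
      rw [Nat.cast_succ, ← add_assoc]
      rcases ih with ih | ih
      · right
        rw [(neighbors_of_leaf h1 ih).1, ha.1]
      · left
        rw [(neighbors_of_leaf h2 ih).1, add_sub_cancel_right]
  constructor
  · refine (Finset.card_le_card (t := {w l, w (l + 1)}) fun v hv => ?_).trans Finset.card_le_two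
    obtain ⟨k, -, rfl⟩ := Finset.mem_image.1 hv
    have := hall (k - l : Fin (q + 1)).val
    rw [Fin.cast_val_eq_self, add_sub_cancel] at this
    simpa using this
  · by_contra hq'
    obtain rfl : q = 2 := by omega
    have h3 : ∀ l : Fin (2 + 1), l + 1 + 1 = l - 1 := by decide
    rw [h3, ← ha.1] at hb
    exact hb.2 rfl

open Fin.CommRing in
/-- A closed walk has fewer leaves than half of its length, or only two vertices, or it goes around
a star, with a loop at its centre if the length is odd. -/
theorem walkLeaves_cases {q : ℕ} (hq : 2 ≤ q) (w : Fin (q + 1) → ℕ) :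
    (walkLeaves w).card + 1 ≤ (q + 1) / 2 ∨ ((Finset.univ.image w).card ≤ 2 ∧ 3 ≤ q) ∨
    ((walkLeaves w).card = (q + 1) / 2 ∧ ∃ c ∉ walkLeaves w,
      Finset.univ.image w = insert c (walkLeaves w) ∧
        (q ≠ 3 → 3 ≤ edgesDegree (walkEdges w) c)) := by
  set Q : Finset (Fin (q + 1)) :=
    Finset.univ.filter fun l => edgesDegree (walkEdges w) (w l) = 1 with hQ
  have hmemQ : ∀ l, l ∈ Q ↔ edgesDegree (walkEdges w) (w l) = 1 := fun l => by simp [hQ]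
  by_cases hadj : ∃ l, l ∈ Q ∧ l + 1 ∈ Q
  · obtain ⟨l, hl, hl'⟩ := hadj
    exact Or.inr (Or.inl (card_image_of_adjacent_leaves hq ((hmemQ _).1 hl) ((hmemQ _).1 hl')))
  push Not at hadj
  have hL : walkLeaves w = Q.image w := by
    ext v
    simp only [walkLeaves, Finset.mem_filter, Finset.mem_image, Finset.mem_univ, true_and, hmemQ]
    constructor
    · rintro ⟨⟨l, rfl⟩, h⟩
      exact ⟨l, h, rfl⟩
    · rintro ⟨l, h, rfl⟩
      exact ⟨⟨l, rfl⟩, h⟩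
  have hLQ : (walkLeaves w).card ≤ Q.card := hL ▸ Finset.card_image_le
  -- The positions right after a leaf. Since no two leaf positions are consecutive, `Q` and `Q'` are
  -- disjoint, so there are at most half as many leaf positions as positions.
  set Q' := Q.map (addRightEmbedding 1) with hQ'
  have hmemQ' : ∀ l, l ∈ Q' ↔ l - 1 ∈ Q := fun l => by
    rw [hQ', Finset.mem_map]
    constructor
    · rintro ⟨a, ha, rfl⟩
      simpa using ha
    · intro h
      exact ⟨l - 1, h, by simp⟩
  have hdisj : Disjoint Q Q' := by
    rw [Finset.disjoint_left]
    intro l hl hl'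
    rw [hmemQ'] at hl'
    exact hadj _ hl' (by simpa using hl)
  have hcard : (Q ∪ Q').card = 2 * Q.card := by
    rw [Finset.card_union_of_disjoint hdisj, hQ', Finset.card_map]; ring
  have hcompl := Finset.card_compl (Q ∪ Q')
  have hle := Finset.card_le_univ (Q ∪ Q')
  rw [Fintype.card_fin] at hcompl hle
  rw [hcard] at hcompl hle
  rcases Nat.lt_or_ge (walkLeaves w).card ((q + 1) / 2) with hlt | hge
  · exact Or.inl hlt
  have hQcard : Q.card = (q + 1) / 2 := by omega
  have hbad_iff : ∀ l, l ∈ (Q ∪ Q')ᶜ ↔ l ∉ Q ∧ l - 1 ∉ Q := fun l => by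
    rw [Finset.mem_compl, Finset.mem_union, hmemQ', not_or]
  have hone : ((Q ∪ Q')ᶜ).card ≤ 1 := by omega
  -- At most one position lies outside `Q ∪ Q'`; the base point is that position if it exists. Going
  -- round from `z`, any other non-leaf position comes right after a leaf, and the step over the
  -- leaf returns to the vertex before it.
  obtain ⟨z, hzQ, hz⟩ : ∃ z, z ∉ Q ∧ ∀ l ∈ (Q ∪ Q')ᶜ, l = z := by
    rcases ((Q ∪ Q')ᶜ).eq_empty_or_nonempty with h | ⟨z, hz⟩
    · obtain ⟨z, -, hz⟩ := Finset.exists_mem_notMem_of_card_lt_card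
        (s := Q) (t := Finset.univ) (by rw [Finset.card_univ, Fintype.card_fin]; omega)
      exact ⟨z, hz, fun l hl => by rw [h] at hl; simp at hl⟩
    · exact ⟨z, ((hbad_iff z).1 hz).1, fun l hl => Finset.card_le_one.1 hone _ hl _ hz⟩
  have hconst' : ∀ j : ℕ, z + (j : Fin (q + 1)) ∉ Q → w (z + (j : Fin (q + 1))) = w z := by
    intro j
    induction j using Nat.strong_induction_on with
    | _ j ih =>
      intro hj
      rcases j with _ | j
      · simp
      have hcast : z + ((j + 1 : ℕ) : Fin (q + 1)) = z + (j : Fin (q + 1)) + 1 := by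
        rw [Nat.cast_succ, add_assoc]
      by_cases hj' : z + (j : Fin (q + 1)) ∈ Q
      · rcases j with _ | i
        · simp only [Nat.cast_zero, add_zero] at hj'
          exact absurd hj' hzQ
        have hi : z + (i : Fin (q + 1)) + 1 ∈ Q := by
          rwa [add_assoc, ← Nat.cast_succ]
        have hi' : z + (i : Fin (q + 1)) ∉ Q := fun h => hadj _ h hi
        have h2 := (neighbors_of_leaf ((hmemQ _).1 hi) rfl).1
        rw [hcast, Nat.cast_succ, ← add_assoc, h2, add_sub_cancel_right]
        exact ih i (by omega) hi'
      · have := hz _ ((hbad_iff _).2 ⟨hj, by rwa [hcast, add_sub_cancel_right]⟩)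
        rw [this]
  have hconst : ∀ l, l ∉ Q → w l = w z := by
    intro l hl
    have := hconst' (l - z : Fin (q + 1)).val
    rw [Fin.cast_val_eq_self, add_sub_cancel] at this
    exact this hl
  have hcL : w z ∉ walkLeaves w := by
    rw [walkLeaves, Finset.mem_filter, ← hmemQ]
    exact fun h => hzQ h.2
  refine Or.inr (Or.inr ⟨by omega, w z, hcL, ?_, ?_⟩)
  · ext v
    simp only [Finset.mem_image, Finset.mem_univ, true_and, Finset.mem_insert]
    constructor
    · rintro ⟨l, rfl⟩
      by_cases hl : l ∈ Q
      · exact Or.inr (hL ▸ Finset.mem_image_of_mem w hl)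
      · exact Or.inl (hconst l hl)
    · rintro (rfl | h)
      · exact ⟨z, rfl⟩
      · rw [hL, Finset.mem_image] at h
        obtain ⟨l, -, rfl⟩ := h
        exact ⟨l, rfl⟩
  · intro hq3
    have hdeg := card_neighbors_le (E := walkEdges w) (c := w z) (N := walkLeaves w) (by
      intro u hu
      refine ⟨fun h => hcL (h ▸ hu), ?_⟩
      rw [hL, Finset.mem_image] at hu
      obtain ⟨l, hl, rfl⟩ := hu
      have := orderedPair_mem_walkEdges w l
      rwa [hconst (l + 1) (hadj l hl)] at this)
    -- An even length is at least 6 here, giving three leaves. In odd length the uncovered position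
    -- and its predecessor both carry the centre, so a loop adds 2 to the contribution of at least
    -- one leaf.
    rcases Nat.even_or_odd (q + 1) with ⟨k, hk⟩ | ⟨k, hk⟩
    · omega
    · obtain ⟨b, hb⟩ : ((Q ∪ Q')ᶜ).Nonempty := Finset.card_pos.1 (by omega)
      obtain ⟨hb1, hb2⟩ := (hbad_iff b).1 hb
      have := orderedPair_sub_mem_walkEdges w b
      rw [hconst b hb1, hconst _ hb2] at this
      simp only [orderedPair, max_self, min_self] at this
      rw [if_pos this] at hdeg
      omega

/-! ### Estimates of the vertex sums -/

/-- Comparison with the telescoping sum of 2(√(n+1) - √n); the slack is a square. -/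
theorem vertexSum_one_le (n : ℕ) : vertexSum n 1 ≤ 2 * √n := by
  induction n with
  | zero => simp [vertexSum]
  | succ n ih =>
    rw [vertexSum, Finset.sum_range_succ, ← vertexSum]
    refine (add_le_add_left ih _).trans ?_
    have h1 : 0 < √((n : ℝ) + 1) := by positivity
    have h2 : √(n : ℝ) ^ 2 = n := Real.sq_sqrt (by positivity)
    have h3 : √((n : ℝ) + 1) ^ 2 = n + 1 := Real.sq_sqrt (by positivity)
    push_cast
    rw [pow_one, ← sub_nonneg]
    have h4 : 2 * √((n : ℝ) + 1) - (2 * √n + (√((n : ℝ) + 1))⁻¹) =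
        (√((n : ℝ) + 1) - √n) ^ 2 / √((n : ℝ) + 1) := by
      field_simp
      nlinarith
    rw [h4]
    positivity

theorem vertexSum_two (n : ℕ) : vertexSum n 2 = ∑ i ∈ Finset.range n, 1 / ((i : ℝ) + 1) := by
  refine Finset.sum_congr rfl fun i _ => ?_
  rw [inv_pow, Real.sq_sqrt (by positivity), one_div]

theorem vertexSum_two_le (n : ℕ) : vertexSum n 2 ≤ 1 + Real.log n := by
  refine le_trans (le_of_eq ?_) (harmonic_le_one_add_log n)
  rw [vertexSum_two, harmonic]
  push_cast
  simp

theorem vertexSum_three_le (n : ℕ) : vertexSum n 3 ≤ 3 := by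
  have key : ∀ n : ℕ, vertexSum (n + 1) 3 ≤ 3 - 2 / √((n : ℝ) + 1) := by
    intro n
    induction n with
    | zero => simp [vertexSum]; norm_num
    | succ n ih =>
      rw [vertexSum, Finset.sum_range_succ, ← vertexSum]
      refine (add_le_add_left ih _).trans ?_
      push_cast
      set a := √((n : ℝ) + 1) with ha
      set b := √((n : ℝ) + 1 + 1) with hb
      have h1 : 0 < a := by positivity
      have h2 : 0 < b := by positivity
      have hab : a ≤ b := Real.sqrt_le_sqrt (by linarith)
      have h3 : a ^ 2 = n + 1 := Real.sq_sqrt (by positivity)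
      have h4 : b ^ 2 = n + 1 + 1 := Real.sq_sqrt (by positivity)
      -- The telescoping comparison, a discrete form of the integral of x^(-3/2).
      have h5 : b⁻¹ ^ 3 ≤ 2 / a - 2 / b := by
        have h6 : 2 / a - 2 / b = 2 / (a * b * (a + b)) := by
          field_simp
          nlinarith
        rw [h6, inv_pow, ← one_div, div_le_div_iff₀ (by positivity) (by positivity)]
        nlinarith [mul_pos h1 h2, mul_le_mul hab hab h1.le h2.le, mul_nonneg h2.le (sub_nonneg.2 hab)]
      linarith
  rcases n with _ | n
  · simp [vertexSum]
  · have := key n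
    have : 0 ≤ 2 / √((n : ℝ) + 1) := by positivity
    linarith [key n]

theorem vertexSum_anti {n d d' : ℕ} (h : d ≤ d') : vertexSum n d' ≤ vertexSum n d :=
  Finset.sum_le_sum fun i _ => pow_le_pow_of_le_one (by positivity) (inv_sqrt_le_one i) h

theorem prod_vertexSum_le {q n : ℕ} (hn : 1 ≤ n) (w : Fin (q + 1) → ℕ) :
    ∏ v ∈ Finset.univ.image w, vertexSum n (min (edgesDegree (walkEdges w) v) 3) ≤
      (2 * √n) ^ (walkLeaves w).card * (1 + Real.log n) ^ (q + 1) := by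
  have hlog : 0 ≤ Real.log n := Real.log_nonneg (by exact_mod_cast hn)
  rw [← Finset.prod_filter_mul_prod_filter_not (Finset.univ.image w)
    fun v => edgesDegree (walkEdges w) v = 1]
  refine mul_le_mul ?_ ?_ (Finset.prod_nonneg fun _ _ => vertexSum_nonneg _ _) (by positivity)
  · rw [walkLeaves, ← Finset.prod_const]
    refine Finset.prod_le_prod (fun _ _ => vertexSum_nonneg _ _) fun v hv => ?_
    rw [(Finset.mem_filter.1 hv).2]
    exact vertexSum_one_le n
  · have h1 : ∀ v ∈ (Finset.univ.image w).filter (fun v => ¬ edgesDegree (walkEdges w) v = 1),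
        vertexSum n (min (edgesDegree (walkEdges w) v) 3) ≤ 1 + Real.log n := by
      intro v hv
      rw [Finset.mem_filter] at hv
      obtain ⟨l, -, rfl⟩ := Finset.mem_image.1 hv.1
      have := edgesDegree_pos w l
      exact (vertexSum_anti (by omega)).trans (vertexSum_two_le n)
    refine (Finset.prod_le_prod (fun _ _ => vertexSum_nonneg _ _) h1).trans ?_
    rw [Finset.prod_const]
    refine pow_le_pow_right₀ (by linarith) ?_
    exact (Finset.card_filter_le _ _).trans (Finset.card_image_le.trans (by simp))

theorem exists_log_pow_le_sqrt (p : ℕ) : ∃ C : ℝ, 0 < C ∧ ∀ n : ℕ, 1 ≤ n →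
    (1 + Real.log n) ^ p ≤ C * √n := by
  -- Chosen so that ε p ≤ 1/2.
  set ε : ℝ := 1 / (2 * (p + 1)) with hε
  have hε0 : 0 < ε := by positivity
  refine ⟨(1 + 1 / ε) ^ p, by positivity, fun n hn => ?_⟩
  have hn1 : (1 : ℝ) ≤ n := by exact_mod_cast hn
  have h1 : 1 + Real.log n ≤ (1 + 1 / ε) * (n : ℝ) ^ ε := by
    have h2 := Real.log_le_rpow_div (x := n) (by positivity) hε0
    have h3 := Real.one_le_rpow hn1 hε0.le
    calc _ ≤ (n : ℝ) ^ ε + (n : ℝ) ^ ε / ε := add_le_add h3 h2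
      _ = _ := by ring
  calc (1 + Real.log n) ^ p ≤ ((1 + 1 / ε) * (n : ℝ) ^ ε) ^ p :=
        pow_le_pow_left₀ (by have := Real.log_nonneg hn1; positivity) h1 p
    _ = (1 + 1 / ε) ^ p * (n : ℝ) ^ (ε * p) := by
        rw [mul_pow, ← Real.rpow_mul_natCast (by positivity)]
    _ ≤ _ := by
        rw [Real.sqrt_eq_rpow]
        gcongr
        · rw [hε, div_mul_eq_mul_div, div_le_div_iff₀ (by positivity) (by norm_num)]
          linarith

theorem exists_prod_vertexSum_le {q : ℕ} (hq : 2 ≤ q) (hq3 : q ≠ 3) :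
    ∃ C : ℝ, 0 < C ∧ ∀ n : ℕ, 1 ≤ n → ∀ w : Fin (q + 1) → ℕ,
      ∏ v ∈ Finset.univ.image w, vertexSum n (min (edgesDegree (walkEdges w) v) 3) ≤
        C * √n ^ ((q + 1) / 2) := by
  obtain ⟨C, hC, hlog⟩ := exists_log_pow_le_sqrt (q + 1)
  set h := (q + 1) / 2 with hh
  -- One summand for each case of `walkLeaves_cases`: few leaves with logarithms, two vertices, and
  -- a star whose centre contributes at most 3.
  refine ⟨2 ^ h * C + 4 + 2 ^ h * 3, by positivity, fun n hn w => ?_⟩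
  have hs1 : 1 ≤ √(n : ℝ) := Real.one_le_sqrt.2 (by exact_mod_cast hn)
  have hs0 : 0 < √(n : ℝ) := by positivity
  rw [add_mul, add_mul]
  have p1 : 0 ≤ 2 ^ h * C * √(n : ℝ) ^ h := by positivity
  have p2 : 0 ≤ 4 * √(n : ℝ) ^ h := by positivity
  have p3 : 0 ≤ 2 ^ h * 3 * √(n : ℝ) ^ h := by positivity
  have hdeg : ∀ v ∈ Finset.univ.image w, 1 ≤ min (edgesDegree (walkEdges w) v) 3 := by
    intro v hv
    obtain ⟨l, -, rfl⟩ := Finset.mem_image.1 hv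
    have := edgesDegree_pos w l
    omega
  rcases walkLeaves_cases hq w with h1 | ⟨h1, h2⟩ | ⟨h1, c, hc, himg, h3⟩
  · have := prod_vertexSum_le hn w
    have h2 : (2 * √(n : ℝ)) ^ (walkLeaves w).card * (1 + Real.log n) ^ (q + 1) ≤
        2 ^ h * C * √(n : ℝ) ^ h := by
      calc _ ≤ (2 * √(n : ℝ)) ^ (h - 1) * (C * √n) := by
            gcongr
            · linarith
            · omega
            · exact hlog n hn
        _ = 2 ^ (h - 1) * C * (√(n : ℝ) ^ (h - 1 + 1)) := by ring
        _ ≤ _ := by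
            rw [Nat.sub_add_cancel (by omega)]
            gcongr
            · norm_num
            · omega
    linarith
  · have : ∏ v ∈ Finset.univ.image w, vertexSum n (min (edgesDegree (walkEdges w) v) 3) ≤
        4 * √(n : ℝ) ^ h := by
      calc _ ≤ ∏ v ∈ Finset.univ.image w, 2 * √(n : ℝ) :=
            Finset.prod_le_prod (fun _ _ => vertexSum_nonneg _ _) fun v hv =>
              (vertexSum_anti (hdeg v hv)).trans (vertexSum_one_le n)
        _ ≤ (2 * √(n : ℝ)) ^ 2 := by
            rw [Finset.prod_const]
            exact pow_le_pow_right₀ (by linarith) h1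
        _ = 4 * √(n : ℝ) ^ 2 := by ring
        _ ≤ _ := by
            gcongr
            omega
    linarith
  · have : ∏ v ∈ Finset.univ.image w, vertexSum n (min (edgesDegree (walkEdges w) v) 3) ≤
        2 ^ h * 3 * √(n : ℝ) ^ h := by
      rw [himg, Finset.prod_insert hc, min_eq_right (h3 hq3)]
      calc _ ≤ 3 * ∏ v ∈ walkLeaves w, 2 * √(n : ℝ) := by
            refine mul_le_mul (vertexSum_three_le n) ?_
              (Finset.prod_nonneg fun _ _ => vertexSum_nonneg _ _) (by norm_num)
            refine Finset.prod_le_prod (fun _ _ => vertexSum_nonneg _ _) fun v hv => ?_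
            refine (vertexSum_anti (hdeg v ?_)).trans (vertexSum_one_le n)
            rw [himg]
            exact Finset.mem_insert_of_mem hv
        _ = _ := by
            rw [Finset.prod_const, h1, mul_pow]
            ring
    linarith

/-! ### Spectral moments as expected traces -/

/-- The adjacency matrix of the preferential-attachment graph with choices `x`. -/
noncomputable def blockMatrix (m n : ℕ) (x : ℕ → ℕ) : Matrix (Fin n) (Fin n) ℝ :=
  Matrix.of fun i j => (edgeCount m x (max (i : ℕ) j) (min (i : ℕ) j) : ℝ)

/-- On the support of the law all edges point backwards, so every edge joining two merged vertices
is sent by the larger one. -/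
theorem adjMatrix_prefAttachGraph {m n : ℕ} (hm : 1 ≤ m) {X : Fin (n * m) → Fin (n * m)}
    (hX : IsAttachSeq (n * m) (extendSeq X)) :
    (prefAttachGraph m n X).adjMatrix = blockMatrix m n (extendSeq X) := by
  ext i j
  change ((Finset.univ.filter fun e : Fin (n * m) =>
      s(e.divNat, (X e).divNat) = s(i, j)).card : ℝ) =
    (((block m (max (i : ℕ) j)).filter fun s => extendSeq X s ∈ block m (min (i : ℕ) j)).card : ℝ)
  rw [Nat.cast_inj]
  have hlt : max (i : ℕ) j < n := max_lt i.2 j.2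
  refine Finset.card_bij (fun e _ => (e : ℕ)) ?_ (fun a _ b _ h => Fin.ext h) ?_
  · intro e he
    rw [Finset.mem_filter, Sym2.eq_iff] at he
    have h1 : (X e : ℕ) / m ≤ (e : ℕ) / m := by
      have := hX e e.2
      rw [extendSeq_apply] at this
      exact Nat.div_le_div_right this
    simp only [Fin.ext_iff, Fin.coe_divNat] at he
    rw [Finset.mem_filter, mem_block hm, mem_block hm, extendSeq_apply]
    omega
  · intro s hs
    rw [Finset.mem_filter] at hs
    have hsn : s < n * m := (Finset.mem_Ico.1 hs.1).2.trans_le (Nat.mul_le_mul_right m hlt)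
    refine ⟨⟨s, hsn⟩, ?_, rfl⟩
    rw [mem_block hm, mem_block hm] at hs
    have h2 := extendSeq_apply X ⟨s, hsn⟩
    simp only at h2
    rw [h2] at hs
    rw [Finset.mem_filter, Sym2.eq_iff]
    simp only [Fin.ext_iff, Fin.coe_divNat]
    refine ⟨Finset.mem_univ _, ?_⟩
    omega

theorem sum_eigenvalues_pow {n : ℕ} {A : Matrix (Fin n) (Fin n) ℝ} (hA : A.IsHermitian) (k : ℕ) :
    ∑ i, hA.eigenvalues i ^ k = (A ^ k).trace := by
  conv_rhs => rw [hA.spectral_theorem]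
  rw [← map_pow, Unitary.conjStarAlgAut_apply, Matrix.trace_mul_cycle, Unitary.coe_star_mul_self, one_mul,
    Matrix.diagonal_pow, Matrix.trace_diagonal]
  simp

theorem spectralMoment_eq {m n : ℕ} (hm : 1 ≤ m) (hn : 1 ≤ n) (k : ℕ) :
    spectralMoment m k n = (n : ℝ)⁻¹ * attachExp (n * m) fun x => (blockMatrix m n x ^ k).trace := by
  have hspec : ∀ X : Fin (n * m) → Fin (n * m),
      Integrable (fun x : ℝ => x ^ k) (prefAttachGraph m n X).spectralMeasure ∧
      ∫ x, x ^ k ∂(prefAttachGraph m n X).spectralMeasure =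
        (n : ℝ)⁻¹ * ((prefAttachGraph m n X).adjMatrix ^ k).trace := by
    intro X
    have h1 : ∀ i ∈ Finset.univ, Integrable (fun x : ℝ => x ^ k)
        (Measure.dirac ((prefAttachGraph m n X).adjMatrix_isHermitian.eigenvalues i)) :=
      fun i _ => integrable_dirac (by finiteness)
    constructor
    · refine Integrable.smul_measure ?_ ?_
      · exact integrable_finsetSum_measure.2 h1
      · simp [Nat.one_le_iff_ne_zero.1 hn]
    · rw [Multigraph.spectralMeasure, integral_smul_measure, integral_finsetSum_measure h1,
        ← sum_eigenvalues_pow (prefAttachGraph m n X).adjMatrix_isHermitian]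
      simp [integral_dirac]
  unfold spectralMoment expectedSpectralMeasure
  rw [integral_finsetSum_measure fun X _ =>
    (hspec X).1.smul_measure (PMF.apply_ne_top _ _), ← sum_prefAttachLaw_eq_attachExp,
    Finset.mul_sum]
  refine Finset.sum_congr rfl fun X _ => ?_
  rw [integral_smul_measure, (hspec X).2, smul_eq_mul]
  -- Choices outside the support have weight zero; on the support the two matrices agree.
  by_cases hX : prefAttachLaw (n * m) X = 0
  · simp [hX]
  · rw [adjMatrix_prefAttachGraph hm (isAttachSeq_of_mem_support hX)]
    ring

theorem pow_apply_eq_sum_walks {n : ℕ} (A : Matrix (Fin n) (Fin n) ℝ) (q : ℕ) (i j : Fin n) :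
    (A ^ q) i j = ∑ w : Fin (q + 1) → Fin n,
      if w 0 = i ∧ w (Fin.last q) = j then ∏ l : Fin q, A (w l.castSucc) (w l.succ) else 0 := by
  induction q generalizing j with
  | zero =>
    rw [pow_zero, ← (Equiv.funUnique (Fin 1) (Fin n)).symm.sum_comp]
    simp only [Equiv.funUnique_symm_apply, uniqueElim_const, Finset.univ_eq_empty,
      Finset.prod_empty, Matrix.one_apply]
    rw [Finset.sum_eq_single i]
    · simp
    · intro b _ hb
      simp [hb]
    · simp
  | succ q ih =>
    rw [pow_succ, Matrix.mul_apply, ← (Fin.snocEquiv fun _ => Fin n).sum_comp,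
      Fintype.sum_prod_type, Finset.sum_comm]
    simp only [ih, Finset.sum_mul]
    rw [Finset.sum_comm]
    refine Finset.sum_congr rfl fun w _ => ?_
    have h1 : ∀ b : Fin n, (Fin.snocEquiv fun _ : Fin (q + 1 + 1) => Fin n) (b, w) =
        Fin.snoc w b := fun b => rfl
    simp only [h1, Fin.snoc_last, Fin.prod_univ_castSucc (n := q), Fin.snoc_castSucc]
    have h2 : ∀ b : Fin n, (Fin.snoc (α := fun _ => Fin n) w b : Fin (q + 1 + 1) → Fin n) 0 = w 0 :=
      fun b => Fin.snoc_castSucc (α := fun _ => Fin n) (i := 0) (x := b) (p := w)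
    simp only [h2, Fin.succ_last, Fin.snoc_last, ← Fin.castSucc_succ, Fin.snoc_castSucc]
    by_cases hi : w 0 = i
    · simp [hi]
    · simp [hi]

theorem trace_pow_eq_sum_walks {n : ℕ} (A : Matrix (Fin n) (Fin n) ℝ) (q : ℕ) :
    (A ^ (q + 1)).trace = ∑ w : Fin (q + 1) → Fin n, ∏ l, A (w l) (w (l + 1)) := by
  rw [pow_succ, Matrix.trace]
  simp only [Matrix.diag_apply, Matrix.mul_apply, pow_apply_eq_sum_walks, Finset.sum_mul]
  have h1 : ∀ i j : Fin n, ∑ w : Fin (q + 1) → Fin n, (if w 0 = i ∧ w (Fin.last q) = j then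
      ∏ l : Fin q, A (w l.castSucc) (w l.succ) else 0) * A j i =
      ∑ w : Fin (q + 1) → Fin n, if w (Fin.last q) = j then if w 0 = i then
        ∏ l, A (w l) (w (l + 1)) else 0 else 0 := by
    intro i j
    refine Finset.sum_congr rfl fun w _ => ?_
    by_cases hi : w 0 = i
    · by_cases hj : w (Fin.last q) = j
      -- The separate last factor is the edge closing the walk, since `Fin.last q + 1 = 0`.
      · rw [if_pos ⟨hi, hj⟩, if_pos hj, if_pos hi, Fin.prod_univ_castSucc]
        simp only [Fin.coeSucc_eq_succ, Fin.last_add_one, hi, hj]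
      · simp [hj]
    · simp [hi]
  simp only [h1]
  rw [Finset.sum_comm' (t' := Finset.univ) (s' := fun _ => Finset.univ) (by simp)]
  simp only [Finset.sum_comm (s := Finset.univ (α := Fin n)) (t := Finset.univ (α := Fin (q + 1) → Fin n))]
  simp

/-- The trace of a power of the adjacency matrix counts closed walks with multiplicity. -/
theorem trace_blockMatrix_pow (m n : ℕ) (x : ℕ → ℕ) (q : ℕ) :
    (blockMatrix m n x ^ (q + 1)).trace =
      ∑ w ∈ Fintype.piFinset fun _ : Fin (q + 1) => Finset.range n,
        ∏ l, (edgeCount m x (max (w l) (w (l + 1))) (min (w l) (w (l + 1))) : ℝ) := by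
  rw [trace_pow_eq_sum_walks]
  refine Finset.sum_bij (fun w _ l => (w l : ℕ)) ?_ ?_ ?_ ?_
  · intro w _
    simp
  · intro w _ w' _ h
    ext l
    exact congrFun h l
  · intro w hw
    rw [Fintype.mem_piFinset] at hw
    exact ⟨fun l => ⟨w l, Finset.mem_range.1 (hw l)⟩, Finset.mem_univ _, rfl⟩
  · intro w _
    rfl

/-! ### Upper bounds -/

theorem attachExp_sum_walks_le {m n q : ℕ} (hm : 1 ≤ m) (W : Finset (Fin (q + 1) → ℕ))
    (hW : ∀ w ∈ W, ∀ l, w l < n) {B : ℝ} (hB0 : 0 ≤ B)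
    (hB : ∀ w ∈ W, ∏ v ∈ Finset.univ.image w,
      vertexSum n (min (edgesDegree (walkEdges w) v) 3) ≤ B) :
    attachExp (n * m) (fun x => ∑ w ∈ W, ∏ l, (edgeCount m x (max (w l) (w (l + 1)))
      (min (w l) (w (l + 1))) : ℝ)) ≤
      ((m ^ 3 * (q + 2) : ℕ) : ℝ) ^ (q + 1) * (numWalkTypes q * B) := by
  rw [attachExp_sum]
  refine (Finset.sum_le_sum fun w hw => attachExp_prod_walk_le hm w (hW w hw)).trans ?_
  rw [← Finset.mul_sum]
  gcongr
  exact sum_walks_le W hW hB0 hB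

theorem exists_spectralMoment_le {m q : ℕ} (hm : 1 ≤ m) (hq : 2 ≤ q) (hq3 : q ≠ 3) :
    ∃ C : ℝ, 0 < C ∧ ∀ n : ℕ, 1 ≤ n →
      spectralMoment m (q + 1) n ≤ C * ((n : ℝ)⁻¹ * √n ^ ((q + 1) / 2)) := by
  obtain ⟨C, hC, h⟩ := exists_prod_vertexSum_le hq hq3
  refine ⟨((m ^ 3 * (q + 2) : ℕ) : ℝ) ^ (q + 1) * ((numWalkTypes q + 1) * C), by positivity,
    fun n hn => ?_⟩
  rw [spectralMoment_eq hm hn]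
  simp only [trace_blockMatrix_pow]
  have h1 := attachExp_sum_walks_le (n := n) hm
    (Fintype.piFinset fun _ : Fin (q + 1) => Finset.range n)
    (fun w hw l => Finset.mem_range.1 (Fintype.mem_piFinset.1 hw l))
    (B := C * √n ^ ((q + 1) / 2)) (by positivity) fun w _ => h n hn w
  calc _ ≤ (n : ℝ)⁻¹ * (((m ^ 3 * (q + 2) : ℕ) : ℝ) ^ (q + 1) *
        ((numWalkTypes q + 1) * (C * √n ^ ((q + 1) / 2)))) := by
        gcongr
        refine h1.trans ?_
        gcongr
        linarith
    _ = _ := by ring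

/-! ### Moments of the degrees -/

/-- The number of indices `s < t` with `x s ∈ V`. -/
def hitsIn (t : ℕ) (x : ℕ → ℕ) (V : Finset ℕ) : ℕ := ((Finset.range t).filter fun s => x s ∈ V).card

theorem hitsIn_succ_update (t : ℕ) (x : ℕ → ℕ) (i : ℕ) (V : Finset ℕ) :
    hitsIn (t + 1) (Function.update x t i) V = hitsIn t x V + if i ∈ V then 1 else 0 := by
  unfold hitsIn
  have h : (Finset.range t).filter (fun s => Function.update x t i s ∈ V) =
      (Finset.range t).filter (fun s => x s ∈ V) :=
    Finset.filter_congr fun s hs => by rw [Function.update_of_ne (Finset.mem_range.1 hs).ne]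
  rw [Finset.range_add_one, Finset.filter_insert, Function.update_self, h]
  split_ifs
  · rw [Finset.card_insert_of_notMem (by simp)]
  · simp

theorem sum_hits_eq_hitsIn (t : ℕ) (x : ℕ → ℕ) (V : Finset ℕ) :
    ∑ v ∈ V, hits t x v = hitsIn t x V := by
  unfold hits hitsIn
  have hmaps : Set.MapsTo x ((Finset.range t).filter fun s => x s ∈ V : Finset ℕ) (V : Set ℕ) :=
    fun s hs => (Finset.mem_filter.1 (Finset.mem_coe.1 hs)).2
  rw [Finset.card_eq_sum_card_fiberwise hmaps]
  refine Finset.sum_congr rfl fun v hv => ?_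
  rw [Finset.filter_filter]
  congr 1
  refine Finset.filter_congr fun s _ => ?_
  constructor
  · rintro rfl
    exact ⟨hv, rfl⟩
  · exact fun h => h.2

/-- The total degree of a set of vertices is itself a Markov chain: it grows with probability
proportional to itself. The vertex `t` may belong to `V`, because its loop has the same form of
probability. -/
theorem attachExp_succ_hitsIn {t : ℕ} {V : Finset ℕ} (hV : V ⊆ Finset.range (t + 1)) (F : ℕ → ℝ) :
    attachExp (t + 1) (fun x => F (hitsIn (t + 1) x V)) =
      attachExp t fun x => F (hitsIn t x V) +
        (F (hitsIn t x V + 1) - F (hitsIn t x V)) * ((V.card + hitsIn t x V) / (2 * t + 1)) := by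
  rw [attachExp]
  refine attachExp_congr fun x hx => ?_
  have h1 : ∑ i ∈ Finset.range (t + 1), (if i ∈ V then stepProb t x i else 0) =
      (V.card + hitsIn t x V) / (2 * t + 1) := by
    rw [← Finset.sum_filter, Finset.filter_mem_eq_inter, Finset.inter_eq_right.2 hV,
      ← sum_hits_eq_hitsIn]
    unfold stepProb
    rw [← Finset.sum_div, Finset.sum_add_distrib]
    push_cast
    simp
  have h2 : F (hitsIn t x V) = ∑ i ∈ Finset.range (t + 1), stepProb t x i * F (hitsIn t x V) := by
    rw [← Finset.sum_mul, sum_stepProb hx, one_mul]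
  rw [← h1, Finset.mul_sum]
  conv_rhs => enter [1]; rw [h2]
  rw [← Finset.sum_add_distrib]
  refine Finset.sum_congr rfl fun i _ => ?_
  rw [hitsIn_succ_update]
  split_ifs
  · ring
  · simp

/-- D(D+1) is an eigenfunction with eigenvalue (2T+3)/(2T+1), and these factors telescope. -/
theorem attachExp_degree_second_moment {V : Finset ℕ} {t : ℕ} (hV : V ⊆ Finset.range t) {T : ℕ}
    (hT : t ≤ T) :
    attachExp T (fun x => ((V.card : ℝ) + hitsIn T x V) * (V.card + hitsIn T x V + 1)) =
      (2 * T + 1) / (2 * t + 1) *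
        attachExp t (fun x => ((V.card : ℝ) + hitsIn t x V) * (V.card + hitsIn t x V + 1)) := by
  induction T, hT using Nat.le_induction with
  | base => rw [div_self (by positivity), one_mul]
  | succ T hT ih =>
    have hV' : V ⊆ Finset.range (T + 1) := hV.trans (Finset.range_subset_range.2 (by omega))
    have h := attachExp_succ_hitsIn hV' fun h => ((V.card : ℝ) + h) * (V.card + h + 1)
    rw [h]
    have h2 : (2 * ((T + 1 : ℕ) : ℝ) + 1) / (2 * t + 1) =
        (2 * (T : ℝ) + 3) / (2 * T + 1) * ((2 * T + 1) / (2 * t + 1)) := by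
      push_cast
      field_simp
      ring
    rw [h2, mul_assoc, ← ih, ← attachExp_const_mul]
    congr 1
    ext x
    push_cast
    field_simp
    ring

/-- The mean degree is multiplied by (2t+2)/(2t+1), whose square exceeds (2t+3)/(2t+1). -/
theorem sqrt_le_attachExp_degree_zero (t : ℕ) :
    √(2 * t + 1) ≤ attachExp t fun x => 1 + (hitsIn t x {0} : ℝ) := by
  induction t with
  | zero => simp [attachExp, hitsIn]
  | succ t ih =>
    have h := attachExp_succ_hitsIn (t := t) (V := {0}) (by simp) fun h => 1 + (h : ℝ)
    rw [h]
    have h2 : attachExp t (fun x => 1 + (hitsIn t x {0} : ℝ) +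
        (1 + ((hitsIn t x {0} + 1 : ℕ) : ℝ) - (1 + (hitsIn t x {0} : ℝ))) *
          (((({0} : Finset ℕ).card : ℝ) + hitsIn t x {0}) / (2 * t + 1))) =
        (2 * t + 2) / (2 * t + 1) * attachExp t fun x => 1 + (hitsIn t x {0} : ℝ) := by
      rw [← attachExp_const_mul]
      congr 1
      ext x
      push_cast [Finset.card_singleton]
      field_simp
      ring
    rw [h2]
    refine le_trans ?_ (mul_le_mul_of_nonneg_left ih (by positivity))
    refine Real.sqrt_le_left (by positivity) |>.2 ?_
    rw [mul_pow, Real.sq_sqrt (by positivity), div_pow]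
    push_cast
    rw [div_mul_eq_mul_div, le_div_iff₀ (by positivity)]
    nlinarith [Nat.cast_nonneg (α := ℝ) t]

theorem attachExp_card_loops (t : ℕ) :
    attachExp t (fun x => (((Finset.range t).filter fun s => x s = s).card : ℝ)) =
      ∑ s ∈ Finset.range t, 1 / (2 * (s : ℝ) + 1) := by
  induction t with
  | zero => simp [attachExp]
  | succ t ih =>
    rw [attachExp, Finset.sum_range_succ, ← ih, ← attachExp_const t (1 / (2 * (t : ℝ) + 1)),
      ← attachExp_add]
    refine attachExp_congr fun x hx => ?_
    have h1 : ∀ i, (((Finset.range (t + 1)).filter fun s => Function.update x t i s = s).card : ℝ) =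
        ((Finset.range t).filter fun s => x s = s).card + if t = i then 1 else 0 := by
      intro i
      have h : (Finset.range t).filter (fun s => Function.update x t i s = s) =
          (Finset.range t).filter (fun s => x s = s) :=
        Finset.filter_congr fun s hs => by rw [Function.update_of_ne (Finset.mem_range.1 hs).ne]
      rw [Finset.range_add_one, Finset.filter_insert, Function.update_self, h]
      by_cases hi : i = t
      · rw [if_pos hi, if_pos hi.symm, Finset.card_insert_of_notMem (by simp)]
        push_cast; ring
      · rw [if_neg hi, if_neg (Ne.symm hi), add_zero]
    simp only [h1, mul_add, Finset.sum_add_distrib]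
    rw [← Finset.sum_mul, sum_stepProb hx, one_mul]
    simp only [mul_ite, mul_one, mul_zero]
    rw [Finset.sum_ite_eq, if_pos (by simp), stepProb, hx.hits_eq_zero le_rfl]
    simp

/-! ### Row sums of the adjacency matrix -/

/-- The number of edges joining the blocks `i` and `j`. -/
def adjCount (m : ℕ) (x : ℕ → ℕ) (i j : ℕ) : ℕ := edgeCount m x (max i j) (min i j)

theorem adjCount_comm (m : ℕ) (x : ℕ → ℕ) (i j : ℕ) : adjCount m x i j = adjCount m x j i := by
  rw [adjCount, adjCount, max_comm, min_comm]

theorem adjCount_le (m : ℕ) (x : ℕ → ℕ) (i j : ℕ) : adjCount m x i j ≤ m := edgeCount_le _ _ _ _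

theorem edgeCount_eq_zero {m n : ℕ} (hm : 1 ≤ m) {x : ℕ → ℕ} (hx : IsAttachSeq (n * m) x) {i j : ℕ}
    (hi : i < n) (hij : i < j) : edgeCount m x i j = 0 := by
  rw [edgeCount, Finset.card_eq_zero, Finset.filter_eq_empty_iff]
  intro s hs h
  have h1 := (Finset.mem_Ico.1 hs).2.trans_le (Nat.mul_le_mul_right m hi)
  have h2 := hx s h1
  rw [mem_block hm] at hs h
  have := Nat.div_le_div_right (c := m) h2
  omega

theorem sum_edgeCount_right {m n : ℕ} (hm : 1 ≤ m) {x : ℕ → ℕ} (hx : IsAttachSeq (n * m) x) {i : ℕ}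
    (hi : i < n) : ∑ j ∈ Finset.range n, edgeCount m x i j = m := by
  conv_rhs => rw [← card_block m i]
  rw [Finset.card_eq_sum_card_fiberwise (f := fun s => x s / m) (t := Finset.range n)]
  · refine Finset.sum_congr rfl fun j _ => ?_
    rw [edgeCount]
    congr 1
    exact Finset.filter_congr fun s _ => mem_block hm
  · intro s hs
    have h1 := (Finset.mem_Ico.1 hs).2.trans_le (Nat.mul_le_mul_right m hi)
    have h2 := hx s h1
    rw [Finset.coe_range, Set.mem_Iio, Nat.div_lt_iff_lt_mul hm]
    omega

theorem sum_edgeCount_left {m n : ℕ} (hm : 1 ≤ m) (x : ℕ → ℕ) (i : ℕ) :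
    ∑ j ∈ Finset.range n, edgeCount m x j i = hitsIn (n * m) x (block m i) := by
  rw [hitsIn, Finset.card_eq_sum_card_fiberwise (f := fun s => s / m) (t := Finset.range n)]
  · refine Finset.sum_congr rfl fun j hj => ?_
    rw [edgeCount]
    congr 1
    ext s
    simp only [Finset.mem_filter, mem_block hm, Finset.mem_range] at hj ⊢
    constructor
    · rintro ⟨rfl, h⟩
      exact ⟨⟨(Nat.div_lt_iff_lt_mul hm).1 hj, h⟩, rfl⟩
    · rintro ⟨⟨h1, h2⟩, h3⟩
      exact ⟨h3, h2⟩
  · intro s hs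
    rw [Finset.coe_range, Set.mem_Iio, Nat.div_lt_iff_lt_mul hm]
    exact Finset.mem_range.1 (Finset.mem_filter.1 hs).1

/-- A row sum counts each loop once while the degree counts it twice, whence the correction term. -/
theorem sum_adjCount_add {m n : ℕ} (hm : 1 ≤ m) {x : ℕ → ℕ} (hx : IsAttachSeq (n * m) x) {i : ℕ}
    (hi : i < n) :
    ∑ j ∈ Finset.range n, adjCount m x i j + edgeCount m x i i =
      m + hitsIn (n * m) x (block m i) := by
  rw [← sum_edgeCount_left hm x i]
  conv_rhs => enter [1]; rw [← sum_edgeCount_right hm hx hi]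
  rw [← Finset.sum_add_distrib]
  have h1 : edgeCount m x i i = ∑ j ∈ Finset.range n, if i = j then edgeCount m x i i else 0 := by
    rw [Finset.sum_ite_eq, if_pos (Finset.mem_range.2 hi)]
  rw [h1, ← Finset.sum_add_distrib]
  refine Finset.sum_congr rfl fun j hj => ?_
  unfold adjCount
  rcases lt_trichotomy i j with h | rfl | h
  · rw [if_neg h.ne, max_eq_right h.le, min_eq_left h.le, edgeCount_eq_zero hm hx hi h]
    omega
  · simp
  · rw [if_neg h.ne', max_eq_left h.le, min_eq_right h.le,
      edgeCount_eq_zero hm hx (Finset.mem_range.1 hj) h]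

theorem sum_blockDegree {m n : ℕ} (hm : 1 ≤ m) {x : ℕ → ℕ} (hx : IsAttachSeq (n * m) x) :
    ∑ i ∈ Finset.range n, (m + hitsIn (n * m) x (block m i)) = 2 * m * n := by
  rw [Finset.sum_add_distrib]
  simp only [← sum_edgeCount_left (n := n) hm x]
  rw [Finset.sum_comm, Finset.sum_congr rfl fun i hi =>
    sum_edgeCount_right hm hx (Finset.mem_range.1 hi)]
  simp
  ring

/-! ### Lower bounds from the first vertex -/

theorem blockMatrix_nonneg (m n : ℕ) (x : ℕ → ℕ) (i j : Fin n) : 0 ≤ blockMatrix m n x i j := by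
  simp [blockMatrix]

theorem pow_apply_nonneg {n : ℕ} {A : Matrix (Fin n) (Fin n) ℝ} (hA : ∀ i j, 0 ≤ A i j) (k : ℕ)
    (i j : Fin n) : 0 ≤ (A ^ k) i j := by
  induction k generalizing j with
  | zero => rw [pow_zero, Matrix.one_apply]; split_ifs <;> norm_num
  | succ k ih =>
    rw [pow_succ, Matrix.mul_apply]
    exact Finset.sum_nonneg fun l _ => mul_nonneg (ih l) (hA _ _)

theorem mul_apply_ge {n : ℕ} {A B : Matrix (Fin n) (Fin n) ℝ} (hA : ∀ i j, 0 ≤ A i j)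
    (hB : ∀ i j, 0 ≤ B i j) (i : Fin n) : A i i * B i i ≤ (A * B) i i := by
  rw [Matrix.mul_apply]
  exact Finset.single_le_sum (f := fun l => A i l * B l i)
    (fun l _ => mul_nonneg (hA _ _) (hB _ _)) (Finset.mem_univ i)

theorem apply_pow_le_pow_apply {n : ℕ} {A : Matrix (Fin n) (Fin n) ℝ} (hA : ∀ i j, 0 ≤ A i j)
    (k : ℕ) (i : Fin n) : A i i ^ k ≤ (A ^ k) i i := by
  induction k with
  | zero => simp
  | succ k ih =>
    rw [pow_succ, pow_succ]
    exact (mul_le_mul_of_nonneg_right ih (hA _ _)).trans (mul_apply_ge (pow_apply_nonneg hA k) hA i)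

/-- Each edge into the first block gives a closed walk of length 2 there, and such walks can be
concatenated. In odd length one step uses the loop of the very first vertex, which is always
present. -/
theorem hitsIn_pow_le_trace {m n : ℕ} (hm : 1 ≤ m) (hn : 1 ≤ n) {x : ℕ → ℕ}
    (hx : IsAttachSeq (n * m) x) (k : ℕ) :
    (hitsIn (n * m) x {0} : ℝ) ^ k ≤ (blockMatrix m n x ^ (2 * k)).trace ∧
    (hitsIn (n * m) x {0} : ℝ) ^ k ≤ (blockMatrix m n x ^ (2 * k + 1)).trace := by
  set A := blockMatrix m n x with hA
  have hA0 := blockMatrix_nonneg m n x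
  rw [← hA] at hA0
  set o : Fin n := ⟨0, hn⟩ with ho
  have htr : ∀ k, (A ^ k) o o ≤ (A ^ k).trace := fun k =>
    Finset.single_le_sum (f := fun i => (A ^ k) i i) (fun i _ => pow_apply_nonneg hA0 k i i)
      (Finset.mem_univ o)
  have h1 : (hitsIn (n * m) x {0} : ℝ) ≤ (A ^ 2) o o := by
    have h2 : hitsIn (n * m) x {0} ≤ hitsIn (n * m) x (block m 0) := by
      refine Finset.card_le_card fun s hs => ?_
      rw [Finset.mem_filter, Finset.mem_singleton] at hs
      rw [Finset.mem_filter, hs.2, mem_block hm]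
      exact ⟨hs.1, by simp⟩
    rw [← sum_edgeCount_left hm] at h2
    refine (Nat.cast_le.2 h2).trans ?_
    rw [pow_two, Matrix.mul_apply, Finset.sum_range]
    push_cast
    refine Finset.sum_le_sum fun j _ => ?_
    have h3 : A o j = edgeCount m x j 0 := by simp [hA, blockMatrix, ho]
    have h4 : A j o = edgeCount m x j 0 := by simp [hA, blockMatrix, ho]
    rw [h3, h4]
    exact_mod_cast Nat.le_mul_self _
  have h2 : (1 : ℝ) ≤ A o o := by
    have h3 : A o o = edgeCount m x 0 0 := by simp [hA, blockMatrix, ho]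
    rw [h3]
    have : 0 < edgeCount m x 0 0 := by
      refine Finset.card_pos.2 ⟨0, Finset.mem_filter.2 ⟨(mem_block hm).2 (by simp), ?_⟩⟩
      have := hx 0 (by positivity)
      rw [Nat.le_zero.1 this, mem_block hm]
      simp
    exact_mod_cast this
  have h3 : (hitsIn (n * m) x {0} : ℝ) ^ k ≤ (A ^ (2 * k)) o o := by
    refine (pow_le_pow_left₀ (by positivity) h1 k).trans ?_
    rw [pow_mul]
    exact apply_pow_le_pow_apply (pow_apply_nonneg hA0 2) k o
  refine ⟨h3.trans (htr _), le_trans ?_ (htr _)⟩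
  rw [pow_succ]
  refine le_trans ?_ (mul_apply_ge (pow_apply_nonneg hA0 _) hA0 o)
  have h4 := pow_apply_nonneg hA0 (2 * k) o o
  nlinarith

theorem spectralMoment_ge {m n : ℕ} (hm : 1 ≤ m) (hn : 1 ≤ n) (k : ℕ) :
    (n : ℝ)⁻¹ * (√n / 2) ^ k ≤ spectralMoment m (2 * k) n ∧
    (n : ℝ)⁻¹ * (√n / 2) ^ k ≤ spectralMoment m (2 * k + 1) n := by
  have hn1 : (1 : ℝ) ≤ n := by exact_mod_cast hn
  have hm1 : (1 : ℝ) ≤ m := by exact_mod_cast hm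
  have hs1 : 1 ≤ √(n : ℝ) := Real.one_le_sqrt.2 hn1
  have hs2 : √(n : ℝ) ^ 2 = n := Real.sq_sqrt (by positivity)
  have h1 : √(n : ℝ) / 2 ≤ attachExp (n * m) fun x => (hitsIn (n * m) x {0} : ℝ) := by
    have h2 := sqrt_le_attachExp_degree_zero (n * m)
    rw [attachExp_add, attachExp_const] at h2
    -- Halving the square root leaves room to subtract the vertex's own outgoing end.
    have h3 : √(n : ℝ) / 2 + 1 ≤ √(2 * (n * m : ℕ) + 1) := by
      apply Real.le_sqrt_of_sq_le
      push_cast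
      nlinarith
    linarith
  have h2 : (√(n : ℝ) / 2) ^ k ≤ attachExp (n * m) fun x => (hitsIn (n * m) x {0} : ℝ) ^ k :=
    (pow_le_pow_left₀ (by positivity) h1 k).trans (pow_attachExp_le (fun _ _ => by positivity) k)
  rw [spectralMoment_eq hm hn, spectralMoment_eq hm hn]
  constructor
  · gcongr
    exact h2.trans (attachExp_mono fun x hx => (hitsIn_pow_le_trace hm hn hx k).1)
  · gcongr
    exact h2.trans (attachExp_mono fun x hx => (hitsIn_pow_le_trace hm hn hx k).2)

/-! ### The first moment -/

theorem attachExp_edgeCount_le {m n i j : ℕ} (hm : 1 ≤ m) (hi : i < n) :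
    attachExp (n * m) (fun x => (edgeCount m x i j : ℝ)) ≤ (m * m * 2 : ℕ) * edgeWeight i j := by
  have h := attachExp_prod_edgeCount_le (n := n) hm {(i, j)} (by simpa using hi)
  simpa using h

theorem edgeWeight_self (i : ℕ) : edgeWeight i i = (√((i : ℝ) + 1))⁻¹ ^ 2 := by
  rw [edgeWeight, pow_two]

theorem attachExp_sum_loops_le {m n : ℕ} (hm : 1 ≤ m) :
    attachExp (n * m) (fun x => ∑ i ∈ Finset.range n, (edgeCount m x i i : ℝ)) ≤
      (m * m * 2 : ℕ) * (1 + Real.log n) := by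
  rw [attachExp_sum]
  refine (Finset.sum_le_sum fun i hi => attachExp_edgeCount_le hm (Finset.mem_range.1 hi)).trans ?_
  rw [← Finset.mul_sum]
  gcongr
  simp only [edgeWeight_self]
  exact vertexSum_two_le n

theorem trace_blockMatrix (m n : ℕ) (x : ℕ → ℕ) :
    (blockMatrix m n x ^ 1).trace = ∑ i ∈ Finset.range n, (edgeCount m x i i : ℝ) := by
  rw [pow_one, Matrix.trace, Finset.sum_range]
  simp [blockMatrix]

theorem spectralMoment_one_le {m n : ℕ} (hm : 1 ≤ m) (hn : 1 ≤ n) :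
    spectralMoment m 1 n ≤ (n : ℝ)⁻¹ * ((m * m * 2 : ℕ) * (1 + Real.log n)) := by
  rw [spectralMoment_eq hm hn]
  simp only [trace_blockMatrix]
  gcongr
  exact attachExp_sum_loops_le hm

/-- A loop of the unmerged graph remains a loop after merging, and their expected number is ∑
1/(2s+1), at least half a harmonic sum. -/
theorem spectralMoment_one_ge {m n : ℕ} (hm : 1 ≤ m) (hn : 1 ≤ n) :
    (n : ℝ)⁻¹ * (Real.log n / 2) ≤ spectralMoment m 1 n := by
  rw [spectralMoment_eq hm hn]
  simp only [trace_blockMatrix]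
  gcongr
  have hn1 : (1 : ℝ) ≤ n := by exact_mod_cast hn
  have hm1 : (1 : ℝ) ≤ m := by exact_mod_cast hm
  calc Real.log n / 2 ≤ ∑ s ∈ Finset.range (n * m), 1 / (2 * (s : ℝ) + 1) := by
        have h1 := log_add_one_le_harmonic (n * m)
        have h2 : Real.log n ≤ Real.log ((n * m : ℕ) + 1) := by
          apply Real.log_le_log (by linarith)
          push_cast
          nlinarith
        have h3 : ((harmonic (n * m) : ℚ) : ℝ) / 2 ≤
            ∑ s ∈ Finset.range (n * m), 1 / (2 * (s : ℝ) + 1) := by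
          rw [harmonic]
          push_cast
          rw [Finset.sum_div]
          refine Finset.sum_le_sum fun s _ => ?_
          rw [← one_div, div_div]
          gcongr
          linarith
        push_cast at h1 h2
        linarith
    _ = _ := (attachExp_card_loops (n * m)).symm
    _ ≤ _ := by
        refine attachExp_mono fun x _ => ?_
        rw [← Nat.cast_sum, Nat.cast_le, Finset.card_eq_sum_card_fiberwise (f := fun s => s / m)
          (t := Finset.range n)]
        · refine Finset.sum_le_sum fun i _ => Finset.card_le_card fun s hs => ?_
          simp only [Finset.mem_filter] at hs
          rw [Finset.mem_filter, hs.1.2, mem_block hm]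
          exact ⟨hs.2, hs.2⟩
        · intro s hs
          rw [Finset.coe_range, Set.mem_Iio, Nat.div_lt_iff_lt_mul hm]
          exact Finset.mem_range.1 (Finset.mem_filter.1 hs).1

/-! ### Multiple edges -/

/-- Counts ordered pairs of distinct parallel edges, whose joint probability carries the edge weight
squared. -/
theorem edgeCount_mul_pred_eq_sum (m : ℕ) (x : ℕ → ℕ) (i j : ℕ) :
    (edgeCount m x i j : ℝ) * (edgeCount m x i j - 1) =
      ∑ p ∈ (block m i ×ˢ block m j).offDiag,
        (if x p.1.1 = p.1.2 then (1 : ℝ) else 0) * (if x p.2.1 = p.2.2 then 1 else 0) := by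
  rw [mul_sub, mul_one, edgeCount_eq_sum]
  set B := block m i ×ˢ block m j
  rw [sub_eq_iff_eq_add, Finset.sum_mul_sum, ← Finset.sum_product', ← Finset.diag_union_offDiag,
    Finset.sum_union (Finset.disjoint_diag_offDiag B), add_comm, Finset.sum_diag]
  congr 1
  refine Finset.sum_congr rfl fun z _ => ?_
  split_ifs <;> norm_num

theorem attachExp_double_edge_le {m n i j : ℕ} (hm : 1 ≤ m) (hi : i < n) :
    attachExp (n * m) (fun x => (edgeCount m x i j : ℝ) * (edgeCount m x i j - 1)) ≤
      9 * ((m : ℝ) * m) ^ 2 * edgeWeight i j ^ 2 := by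
  simp only [edgeCount_mul_pred_eq_sum]
  rw [attachExp_sum]
  have key : ∀ p ∈ (block m i ×ˢ block m j).offDiag, attachExp (n * m) (fun x =>
      (if x p.1.1 = p.1.2 then (1 : ℝ) else 0) * (if x p.2.1 = p.2.2 then 1 else 0)) ≤
      9 * edgeWeight i j ^ 2 := by
    rintro ⟨z, z'⟩ hp
    obtain ⟨hz, hz', hne⟩ := Finset.mem_offDiag.1 hp
    have h := attachExp_prod_indicator_le' (n := n) hm (Finset.univ : Finset (Fin 2))
      (fun _ => (i, j)) ![z, z'] ?_ ?_ (fun _ _ => hi)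
    · simp only [Fin.prod_univ_two, Finset.card_univ, Fintype.card_fin] at h
      refine h.trans (le_of_eq ?_)
      norm_num
      ring
    · intro a _ b _ hab
      fin_cases a <;> fin_cases b <;> simp_all
    · intro a _
      fin_cases a
      · exact hz
      · exact hz'
  refine (Finset.sum_le_card_nsmul _ _ _ key).trans ?_
  rw [nsmul_eq_mul]
  have h1 : (((block m i ×ˢ block m j).offDiag.card : ℕ) : ℝ) ≤ ((m : ℝ) * m) ^ 2 := by
    rw [Finset.offDiag_card, Finset.card_product, card_block, card_block]
    have : m * m * (m * m) - m * m ≤ (m * m) ^ 2 := by rw [pow_two]; omega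
    exact_mod_cast this
  calc _ ≤ ((m : ℝ) * m) ^ 2 * (9 * edgeWeight i j ^ 2) := by gcongr
    _ = _ := by ring

theorem attachExp_double_edge_mul_le {m n i j k l : ℕ} (hm : 1 ≤ m) (hi : i < n) (hk : k < n)
    (hne : (i, j) ≠ (k, l)) :
    attachExp (n * m) (fun x => (edgeCount m x k l : ℝ) *
      ((edgeCount m x i j : ℝ) * (edgeCount m x i j - 1))) ≤
      64 * ((m : ℝ) * m) ^ 3 * (edgeWeight i j ^ 2 * edgeWeight k l) := by
  simp only [edgeCount_mul_pred_eq_sum]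
  simp only [edgeCount_eq_sum]
  simp only [Finset.sum_mul_sum]
  simp only [attachExp_sum]
  have key : ∀ z'' ∈ block m k ×ˢ block m l, ∀ p ∈ (block m i ×ˢ block m j).offDiag,
      attachExp (n * m) (fun x => (if x z''.1 = z''.2 then (1 : ℝ) else 0) *
      ((if x p.1.1 = p.1.2 then (1 : ℝ) else 0) * (if x p.2.1 = p.2.2 then 1 else 0))) ≤
      64 * (edgeWeight i j ^ 2 * edgeWeight k l) := by
    rintro z'' hz'' ⟨z, z'⟩ hp
    obtain ⟨hz, hz', hzz⟩ := Finset.mem_offDiag.1 hp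
    have hsep : ∀ z ∈ block m i ×ˢ block m j, z ≠ z'' := by
      rintro z hz rfl
      rw [Finset.mem_product, mem_block hm, mem_block hm] at hz hz''
      exact hne (Prod.ext (hz.1.symm.trans hz''.1) (hz.2.symm.trans hz''.2))
    have h1 := hsep z hz
    have h2 := hsep z' hz'
    have h := attachExp_prod_indicator_le' (n := n) hm (Finset.univ : Finset (Fin 3))
      ![(k, l), (i, j), (i, j)] ![z'', z, z'] ?_ ?_ ?_
    · simp only [Fin.prod_univ_three, Finset.card_univ, Fintype.card_fin] at h
      simp only [← mul_assoc] at h ⊢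
      refine h.trans (le_of_eq ?_)
      simp
      norm_num
      ring
    · intro a _ b _ hab
      have h3 := hzz.symm
      have h4 := h1.symm
      have h5 := h2.symm
      fin_cases a <;> fin_cases b <;> simp_all
    · intro a _
      fin_cases a
      · exact hz''
      · exact hz
      · exact hz'
    · intro a _
      fin_cases a
      · exact hk
      · exact hi
      · exact hi
  refine (Finset.sum_le_sum fun z'' hz'' => Finset.sum_le_card_nsmul _ _ _ (key z'' hz'')).trans ?_
  rw [Finset.sum_const, Finset.card_product, card_block, card_block, nsmul_eq_mul, nsmul_eq_mul]
  have h1 : (((block m i ×ˢ block m j).offDiag.card : ℕ) : ℝ) ≤ ((m : ℝ) * m) ^ 2 := by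
    rw [Finset.offDiag_card, Finset.card_product, card_block, card_block]
    have : m * m * (m * m) - m * m ≤ (m * m) ^ 2 := by rw [pow_two]; omega
    exact_mod_cast this
  have h2 : 0 ≤ edgeWeight k l := edgeWeight_nonneg _ _
  push_cast
  calc _ ≤ ((m : ℝ) * m) * (((m : ℝ) * m) ^ 2 * (64 * (edgeWeight i j ^ 2 * edgeWeight k l))) := by
        gcongr
    _ = _ := by ring

/-- The excess `a (a - 1)` of a multiple edge of multiplicity `a` between the blocks `i`, `j`. -/
noncomputable def adjExcess (m : ℕ) (x : ℕ → ℕ) (i j : ℕ) : ℝ :=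
  (adjCount m x i j : ℝ) * (adjCount m x i j - 1)

theorem adjExcess_nonneg (m : ℕ) (x : ℕ → ℕ) (i j : ℕ) : 0 ≤ adjExcess m x i j := by
  unfold adjExcess
  rcases Nat.eq_zero_or_pos (adjCount m x i j) with h | h
  · simp [h]
  · have : (1 : ℝ) ≤ adjCount m x i j := by exact_mod_cast h
    exact mul_nonneg (by positivity) (by linarith)

theorem edgeWeight_max_min (i j : ℕ) : edgeWeight (max i j) (min i j) = edgeWeight i j := by
  rcases le_total i j with h | h
  · rw [max_eq_right h, min_eq_left h, edgeWeight, edgeWeight, mul_comm]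
  · rw [max_eq_left h, min_eq_right h]

theorem attachExp_adjExcess_le {m n i j : ℕ} (hm : 1 ≤ m) (hi : i < n) (hj : j < n) :
    attachExp (n * m) (fun x => adjExcess m x i j) ≤
      9 * ((m : ℝ) * m) ^ 2 * edgeWeight i j ^ 2 := by
  rw [← edgeWeight_max_min]
  exact attachExp_double_edge_le hm (max_lt hi hj)

/-- For `k ≠ j` three distinct edges are prescribed. For `k = j` they may coincide, so the single
count is bounded by `m`. -/
theorem attachExp_adjCount_mul_adjExcess_le {m n i j k : ℕ} (hm : 1 ≤ m) (hi : i < n) (hj : j < n)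
    (hk : k < n) :
    attachExp (n * m) (fun x => (adjCount m x i k : ℝ) * adjExcess m x i j) ≤
      64 * ((m : ℝ) * m) ^ 3 * (edgeWeight i j ^ 2 * edgeWeight i k) +
        if k = j then m * (9 * ((m : ℝ) * m) ^ 2 * edgeWeight i j ^ 2) else 0 := by
  split_ifs with hkj
  · subst hkj
    have h1 : attachExp (n * m) (fun x => (adjCount m x i k : ℝ) * adjExcess m x i k) ≤
        m * (9 * ((m : ℝ) * m) ^ 2 * edgeWeight i k ^ 2) := by
      refine le_trans ?_ (mul_le_mul_of_nonneg_left (attachExp_adjExcess_le hm hi hk)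
        (Nat.cast_nonneg m))
      rw [← attachExp_const_mul]
      refine attachExp_mono fun x _ => ?_
      have := adjExcess_nonneg m x i k
      gcongr
      exact adjCount_le _ _ _ _
    have h2 : 0 ≤ 64 * ((m : ℝ) * m) ^ 3 * (edgeWeight i k ^ 2 * edgeWeight i k) := by
      have := edgeWeight_nonneg i k
      positivity
    linarith
  · rw [add_zero, ← edgeWeight_max_min i j, ← edgeWeight_max_min i k]
    refine attachExp_double_edge_mul_le hm (max_lt hi hj) (max_lt hi hk) fun h => hkj ?_
    have h1 := congrArg Prod.fst h
    have h2 := congrArg Prod.snd h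
    simp only at h1 h2
    omega

theorem sum_sum_edgeWeight_sq (n : ℕ) :
    ∑ i ∈ Finset.range n, ∑ j ∈ Finset.range n, edgeWeight i j ^ 2 = vertexSum n 2 ^ 2 := by
  rw [pow_two (vertexSum n 2), vertexSum, Finset.sum_mul_sum]
  simp only [edgeWeight, mul_pow]

theorem attachExp_sum_adjExcess_le {m n : ℕ} (hm : 1 ≤ m) :
    attachExp (n * m) (fun x => ∑ i ∈ Finset.range n, ∑ j ∈ Finset.range n, adjExcess m x i j) ≤
      9 * ((m : ℝ) * m) ^ 2 * (1 + Real.log n) ^ 2 := by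
  simp only [attachExp_sum]
  calc _ ≤ ∑ i ∈ Finset.range n, ∑ j ∈ Finset.range n,
        9 * ((m : ℝ) * m) ^ 2 * edgeWeight i j ^ 2 :=
        Finset.sum_le_sum fun i hi => Finset.sum_le_sum fun j hj =>
          attachExp_adjExcess_le hm (Finset.mem_range.1 hi) (Finset.mem_range.1 hj)
    _ = 9 * ((m : ℝ) * m) ^ 2 * vertexSum n 2 ^ 2 := by
        simp only [← Finset.mul_sum, sum_sum_edgeWeight_sq]
    _ ≤ _ := by
        gcongr
        · exact vertexSum_nonneg n 2
        · exact vertexSum_two_le n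

/-- In the main term `i`, `j`, `k` carry exponents 3, 2, 1, so the sum is of order √n log n,
negligible against n. -/
theorem attachExp_sum_adjCount_mul_adjExcess_le {m n : ℕ} (hm : 1 ≤ m) :
    attachExp (n * m) (fun x => ∑ i ∈ Finset.range n,
      (∑ k ∈ Finset.range n, (adjCount m x i k : ℝ)) * ∑ j ∈ Finset.range n, adjExcess m x i j) ≤
      64 * ((m : ℝ) * m) ^ 3 * (3 * (1 + Real.log n) * (2 * √n)) +
        m * (9 * ((m : ℝ) * m) ^ 2 * (1 + Real.log n) ^ 2) := by
  simp only [Finset.sum_mul_sum, attachExp_sum]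
  have hlog : vertexSum n 2 ≤ 1 + Real.log n := vertexSum_two_le n
  have hlog0 : 0 ≤ 1 + Real.log n := (vertexSum_nonneg n 2).trans hlog
  calc _ ≤ ∑ i ∈ Finset.range n, ∑ k ∈ Finset.range n, ∑ j ∈ Finset.range n,
        (64 * ((m : ℝ) * m) ^ 3 * (edgeWeight i j ^ 2 * edgeWeight i k) +
        if k = j then m * (9 * ((m : ℝ) * m) ^ 2 * edgeWeight i j ^ 2) else 0) :=
        Finset.sum_le_sum fun i hi => Finset.sum_le_sum fun k hk => Finset.sum_le_sum fun j hj =>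
          attachExp_adjCount_mul_adjExcess_le hm (Finset.mem_range.1 hi) (Finset.mem_range.1 hj)
            (Finset.mem_range.1 hk)
    _ = 64 * ((m : ℝ) * m) ^ 3 * (vertexSum n 3 * vertexSum n 2 * vertexSum n 1) +
        m * (9 * ((m : ℝ) * m) ^ 2 * vertexSum n 2 ^ 2) := by
        simp only [Finset.sum_add_distrib]
        congr 1
        · simp only [← Finset.mul_sum]
          congr 1
          rw [mul_assoc, vertexSum, Finset.sum_mul]
          refine Finset.sum_congr rfl fun i _ => ?_
          rw [mul_comm (vertexSum n 2), vertexSum, vertexSum, Finset.sum_mul_sum, Finset.mul_sum]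
          refine Finset.sum_congr rfl fun k _ => ?_
          rw [Finset.mul_sum]
          refine Finset.sum_congr rfl fun j _ => ?_
          unfold edgeWeight
          ring
        · rw [← sum_sum_edgeWeight_sq]
          simp only [Finset.mul_sum]
          refine Finset.sum_congr rfl fun i _ => ?_
          refine Finset.sum_congr rfl fun k hk => ?_
          rw [Finset.sum_ite_eq, if_pos hk]
    _ ≤ _ := by
        have h3 := vertexSum_three_le n
        have h1 := vertexSum_one_le n
        have := vertexSum_nonneg n 1
        have := vertexSum_nonneg n 2
        have := vertexSum_nonneg n 3
        gcongr

/-! ### The second moment -/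

theorem trace_blockMatrix_sq (m n : ℕ) (x : ℕ → ℕ) :
    (blockMatrix m n x ^ 2).trace =
      ∑ i ∈ Finset.range n, ∑ j ∈ Finset.range n, (adjCount m x i j : ℝ) ^ 2 := by
  rw [pow_two, Matrix.trace, Finset.sum_range]
  refine Finset.sum_congr rfl fun i _ => ?_
  rw [Matrix.diag_apply, Matrix.mul_apply, Finset.sum_range]
  refine Finset.sum_congr rfl fun j _ => ?_
  change (adjCount m x i j : ℝ) * adjCount m x j i = _
  rw [adjCount_comm m x j i, pow_two]

/-- The degree of the vertex `i` after merging. -/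
noncomputable def blockDegree (m n : ℕ) (x : ℕ → ℕ) (i : ℕ) : ℝ := m + hitsIn (n * m) x (block m i)

theorem sum_adjCount {m n : ℕ} (hm : 1 ≤ m) {x : ℕ → ℕ} (hx : IsAttachSeq (n * m) x) {i : ℕ}
    (hi : i < n) :
    ∑ j ∈ Finset.range n, (adjCount m x i j : ℝ) = blockDegree m n x i - edgeCount m x i i := by
  rw [blockDegree, eq_sub_iff_add_eq]
  exact_mod_cast sum_adjCount_add hm hx hi

theorem sum_blockDegree_cast {m n : ℕ} (hm : 1 ≤ m) {x : ℕ → ℕ} (hx : IsAttachSeq (n * m) x) :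
    ∑ i ∈ Finset.range n, blockDegree m n x i = 2 * m * n := by
  unfold blockDegree
  exact_mod_cast sum_blockDegree hm hx

/-- From a² = a + a(a-1): the linear part is the total degree 2mn minus the loops. -/
theorem trace_blockMatrix_sq_eq {m n : ℕ} (hm : 1 ≤ m) {x : ℕ → ℕ} (hx : IsAttachSeq (n * m) x) :
    (blockMatrix m n x ^ 2).trace = 2 * m * n +
      (∑ i ∈ Finset.range n, ∑ j ∈ Finset.range n, adjExcess m x i j -
        ∑ i ∈ Finset.range n, (edgeCount m x i i : ℝ)) := by
  rw [trace_blockMatrix_sq, ← sum_blockDegree_cast hm hx, add_sub_left_comm, ← Finset.sum_sub_distrib,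
    ← Finset.sum_add_distrib]
  refine Finset.sum_congr rfl fun i hi => ?_
  rw [← sum_adjCount hm hx (Finset.mem_range.1 hi), ← Finset.sum_add_distrib]
  refine Finset.sum_congr rfl fun j _ => ?_
  unfold adjExcess
  ring

theorem exists_abs_spectralMoment_two_sub_le {m : ℕ} (hm : 1 ≤ m) :
    ∃ C : ℝ, 0 < C ∧ ∀ n : ℕ, 1 ≤ n →
      |spectralMoment m 2 n - 2 * m| ≤ C * ((n : ℝ)⁻¹ * √n) := by
  obtain ⟨C, hC, hlog⟩ := exists_log_pow_le_sqrt 2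
  refine ⟨(9 * ((m : ℝ) * m) ^ 2 + (m * m * 2 : ℕ)) * C, by positivity, fun n hn => ?_⟩
  have hn0 : (0 : ℝ) < n := by exact_mod_cast hn
  have hl0 : 0 ≤ Real.log n := Real.log_nonneg (by exact_mod_cast hn)
  have h1 := attachExp_sum_adjExcess_le (n := n) hm
  have h2 := attachExp_sum_loops_le (n := n) hm
  have h3 : 0 ≤ attachExp (n * m)
      (fun x => ∑ i ∈ Finset.range n, ∑ j ∈ Finset.range n, adjExcess m x i j) :=
    attachExp_nonneg fun x _ => Finset.sum_nonneg fun i _ => Finset.sum_nonneg fun j _ =>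
      adjExcess_nonneg _ _ _ _
  have h4 : 0 ≤ attachExp (n * m) (fun x => ∑ i ∈ Finset.range n, (edgeCount m x i i : ℝ)) :=
    attachExp_nonneg fun x _ => by positivity
  have h5 : spectralMoment m 2 n - 2 * m = (n : ℝ)⁻¹ * (attachExp (n * m)
      (fun x => ∑ i ∈ Finset.range n, ∑ j ∈ Finset.range n, adjExcess m x i j) -
      attachExp (n * m) (fun x => ∑ i ∈ Finset.range n, (edgeCount m x i i : ℝ))) := by
    rw [spectralMoment_eq hm hn, attachExp_congr fun x hx => trace_blockMatrix_sq_eq hm hx,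
      attachExp_add, attachExp_const, attachExp_sub]
    field_simp
    ring
  rw [h5, abs_mul, abs_of_pos (inv_pos.2 hn0)]
  have h6 : (1 + Real.log n) ≤ (1 + Real.log n) ^ 2 := by nlinarith
  have h7 : ((m * m * 2 : ℕ) : ℝ) * (1 + Real.log n) ≤ (m * m * 2 : ℕ) * (1 + Real.log n) ^ 2 := by
    gcongr
  have h8 : 0 ≤ 9 * ((m : ℝ) * m) ^ 2 * (1 + Real.log n) ^ 2 := by positivity
  have h9 : 0 ≤ ((m * m * 2 : ℕ) : ℝ) * (1 + Real.log n) ^ 2 := by positivity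
  calc _ ≤ (n : ℝ)⁻¹ * ((9 * ((m : ℝ) * m) ^ 2 + (m * m * 2 : ℕ)) * (1 + Real.log n) ^ 2) := by
        gcongr
        rw [abs_le]
        constructor <;> linarith
    _ ≤ (n : ℝ)⁻¹ * ((9 * ((m : ℝ) * m) ^ 2 + (m * m * 2 : ℕ)) * (C * √n)) := by
        gcongr
        exact hlog n hn
    _ = _ := by ring

/-! ### The sum of squared degrees -/

theorem attachExp_blockDegree_eq {m n i : ℕ} (hi : i < n) :
    attachExp (n * m) (fun x => blockDegree m n x i * (blockDegree m n x i + 1)) =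
      (2 * (n * m : ℕ) + 1) / (2 * ((i + 1) * m : ℕ) + 1) *
        attachExp ((i + 1) * m) fun x =>
          blockDegree m (i + 1) x i * (blockDegree m (i + 1) x i + 1) := by
  have hV : block m i ⊆ Finset.range ((i + 1) * m) := fun s hs =>
    Finset.mem_range.2 (Finset.mem_Ico.1 hs).2
  have h := attachExp_degree_second_moment hV (Nat.mul_le_mul_right m hi : (i + 1) * m ≤ n * m)
  rwa [card_block] at h

/-- Just after block `i` is completed, its degree is `m` plus its number `e` of loops, and e ≤ m
makes the excess of D(D+1) over m(m+1) at most 4me. -/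
theorem attachExp_initial_blockDegree {m : ℕ} (hm : 1 ≤ m) (i : ℕ) :
    (m : ℝ) * (m + 1) ≤ attachExp ((i + 1) * m)
      (fun x => blockDegree m (i + 1) x i * (blockDegree m (i + 1) x i + 1)) ∧
    attachExp ((i + 1) * m)
      (fun x => blockDegree m (i + 1) x i * (blockDegree m (i + 1) x i + 1)) ≤
      m * (m + 1) + 8 * m ^ 3 / (i + 1) := by
  have hm1 : (1 : ℝ) ≤ m := by exact_mod_cast hm
  have hD : ∀ x, IsAttachSeq ((i + 1) * m) x →
      blockDegree m (i + 1) x i = m + edgeCount m x i i := by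
    intro x hx
    rw [blockDegree, ← sum_edgeCount_left hm, Finset.sum_range_succ, Finset.sum_eq_zero, zero_add]
    intro j hj
    have := Finset.mem_range.1 hj
    exact edgeCount_eq_zero hm hx (by omega) this
  constructor
  · rw [← attachExp_const ((i + 1) * m) ((m : ℝ) * (m + 1))]
    refine attachExp_mono fun x hx => ?_
    rw [hD x hx]
    gcongr <;> simp
  · have h1 := attachExp_edgeCount_le (n := i + 1) (j := i) hm (Nat.lt_succ_self i)
    have h2 : attachExp ((i + 1) * m)
        (fun x => blockDegree m (i + 1) x i * (blockDegree m (i + 1) x i + 1)) ≤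
        attachExp ((i + 1) * m) (fun x => (m : ℝ) * (m + 1) + 4 * m * edgeCount m x i i) := by
      refine attachExp_mono fun x hx => ?_
      rw [hD x hx]
      have h3 : (edgeCount m x i i : ℝ) ≤ m := by exact_mod_cast edgeCount_le m x i i
      have h4 : (0 : ℝ) ≤ edgeCount m x i i := by positivity
      nlinarith [mul_nonneg h4 (sub_nonneg.2 h3), mul_nonneg h4 (sub_nonneg.2 hm1)]
    refine h2.trans ?_
    rw [attachExp_add, attachExp_const, attachExp_const_mul]
    gcongr
    calc _ ≤ 4 * (m : ℝ) * ((m * m * 2 : ℕ) * edgeWeight i i) := by gcongr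
      _ = _ := by
        rw [edgeWeight_self, inv_pow, Real.sq_sqrt (by positivity)]
        push_cast
        ring

/-- With I = i + 1, the growth ratio lies between n/I - n/I² and n/I and the initial value is within
8m³/I of m(m+1), so the error is O(n/I²), which is summable in I. -/
theorem attachExp_blockDegree_close {m n i : ℕ} (hm : 1 ≤ m) (hi : i < n) :
    |attachExp (n * m) (fun x => blockDegree m n x i * (blockDegree m n x i + 1)) -
      m * (m + 1) * (n * (1 / ((i : ℝ) + 1)))| ≤
        (m * (m + 1) + 8 * m ^ 3) * n * (√((i : ℝ) + 1))⁻¹ ^ 4 := by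
  obtain ⟨h1, h2⟩ := attachExp_initial_blockDegree hm i
  rw [attachExp_blockDegree_eq hi]
  set E := attachExp ((i + 1) * m)
    (fun x => blockDegree m (i + 1) x i * (blockDegree m (i + 1) x i + 1)) with hE
  have hm1 : (1 : ℝ) ≤ m := by exact_mod_cast hm
  have hin : (i : ℝ) + 1 ≤ n := by exact_mod_cast hi
  have hy : (√((i : ℝ) + 1))⁻¹ ^ 4 = (((i : ℝ) + 1) ^ 2)⁻¹ := by
    rw [inv_pow, show (4 : ℕ) = 2 * 2 from rfl, pow_mul, Real.sq_sqrt (by positivity)]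
  rw [hy]
  push_cast
  set I : ℝ := (i : ℝ) + 1 with hI
  have hI1 : 1 ≤ I := by rw [hI]; linarith [Nat.cast_nonneg (α := ℝ) i]
  have hI0 : 0 < I := by linarith
  have hn0 : (0 : ℝ) < n := by linarith
  set ρ : ℝ := (2 * (n * m) + 1) / (2 * (I * m) + 1) with hρ
  have hρ1 : ρ ≤ n * (1 / I) := by
    rw [hρ, mul_one_div, div_le_div_iff₀ (by positivity) hI0]
    nlinarith
  have hρ2 : n * (1 / I) - n * (I ^ 2)⁻¹ ≤ ρ := by
    have : n * (1 / I) - n * (I ^ 2)⁻¹ = n * (I - 1) / I ^ 2 := by field_simp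
    rw [this, hρ, div_le_div_iff₀ (by positivity) (by positivity)]
    have h3 : 0 ≤ n * I * (m - 1) := mul_nonneg (by positivity) (by linarith)
    nlinarith [mul_pos hn0 hI0]
  have hρ0 : 0 ≤ ρ := by positivity
  have hM : 0 ≤ (m : ℝ) * (m + 1) := by positivity
  have hb : 0 ≤ 8 * (m : ℝ) ^ 3 * n * (I ^ 2)⁻¹ := by positivity
  have hb' : 0 ≤ (m : ℝ) * (m + 1) * n * (I ^ 2)⁻¹ := by positivity
  rw [abs_le]
  constructor
  · have h3 : (m * (m + 1)) * (n * (1 / I) - n * (I ^ 2)⁻¹) ≤ ρ * E := by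
      rw [mul_comm ρ]
      exact mul_le_mul h1 hρ2 (by
        have : n * (1 / I) - n * (I ^ 2)⁻¹ = n * (I - 1) / I ^ 2 := by field_simp
        rw [this]
        exact div_nonneg (mul_nonneg hn0.le (by linarith)) (by positivity)) (hM.trans h1)
    nlinarith
  · have h3 : ρ * E ≤ n * (1 / I) * (m * (m + 1) + 8 * m ^ 3 / I) :=
      mul_le_mul hρ1 h2 (hM.trans h1) (by positivity)
    have h4 : n * (1 / I) * (m * (m + 1) + 8 * m ^ 3 / I) =
        m * (m + 1) * (n * (1 / I)) + 8 * (m : ℝ) ^ 3 * n * (I ^ 2)⁻¹ := by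
      field_simp
    nlinarith

theorem exists_abs_sum_blockDegree_sub_le {m : ℕ} (hm : 1 ≤ m) :
    ∃ C : ℝ, 0 < C ∧ ∀ n : ℕ, 1 ≤ n →
      |attachExp (n * m) (fun x => ∑ i ∈ Finset.range n,
        blockDegree m n x i * (blockDegree m n x i + 1)) - m * (m + 1) * (n * Real.log n)| ≤
        C * n := by
  refine ⟨(m * (m + 1) + 8 * m ^ 3) * 3 + m * (m + 1), by positivity, fun n hn => ?_⟩
  have hn1 : (1 : ℝ) ≤ n := by exact_mod_cast hn
  have h1 : |attachExp (n * m) (fun x => ∑ i ∈ Finset.range n,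
      blockDegree m n x i * (blockDegree m n x i + 1)) - m * (m + 1) * (n * vertexSum n 2)| ≤
      (m * (m + 1) + 8 * m ^ 3) * n * 3 := by
    rw [attachExp_sum, vertexSum_two, Finset.mul_sum, Finset.mul_sum, ← Finset.sum_sub_distrib]
    refine (Finset.abs_sum_le_sum_abs _ _).trans ?_
    refine (Finset.sum_le_sum fun i hi =>
      attachExp_blockDegree_close hm (Finset.mem_range.1 hi)).trans ?_
    rw [← Finset.mul_sum]
    gcongr
    exact (vertexSum_anti (show 3 ≤ 4 by norm_num)).trans (vertexSum_three_le n)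
  have h2 := vertexSum_two_le n
  have h3 : Real.log n ≤ vertexSum n 2 := by
    have h4 := log_add_one_le_harmonic n
    have h5 : ((harmonic n : ℚ) : ℝ) = vertexSum n 2 := by
      rw [vertexSum_two, harmonic]
      push_cast
      simp
    rw [h5] at h4
    refine le_trans (Real.log_le_log (by linarith) ?_) h4
    push_cast
    linarith
  have h4 : |(m : ℝ) * (m + 1) * (n * vertexSum n 2) - m * (m + 1) * (n * Real.log n)| ≤
      m * (m + 1) * n := by
    rw [← mul_sub, ← mul_sub, abs_of_nonneg
      (mul_nonneg (by positivity) (mul_nonneg (by positivity) (by linarith)))]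
    have : n * (vertexSum n 2 - Real.log n) ≤ n * 1 := by gcongr; linarith
    rw [mul_one] at this
    gcongr
  calc _ ≤ _ := abs_sub_le _ (m * (m + 1) * (n * vertexSum n 2)) _
    _ ≤ (m * (m + 1) + 8 * m ^ 3) * n * 3 + m * (m + 1) * n := add_le_add h1 h4
    _ = _ := by ring

/-! ### The fourth moment -/

/-- The sum of a row of the adjacency matrix. -/
noncomputable def rowSum (m n : ℕ) (x : ℕ → ℕ) (i : ℕ) : ℝ :=
  ∑ j ∈ Finset.range n, (adjCount m x i j : ℝ)

/-- The sum of the squares of a row of the adjacency matrix. -/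
noncomputable def rowSqSum (m n : ℕ) (x : ℕ → ℕ) (i : ℕ) : ℝ :=
  ∑ j ∈ Finset.range n, (adjCount m x i j : ℝ) ^ 2

theorem rowSum_nonneg (m n : ℕ) (x : ℕ → ℕ) (i : ℕ) : 0 ≤ rowSum m n x i :=
  Finset.sum_nonneg fun _ _ => Nat.cast_nonneg _

theorem natCast_le_sq (a : ℕ) : (a : ℝ) ≤ (a : ℝ) ^ 2 := by
  have := Nat.le_mul_self a
  rw [pow_two]
  exact_mod_cast this

theorem rowSum_le_rowSqSum (m n : ℕ) (x : ℕ → ℕ) (i : ℕ) : rowSum m n x i ≤ rowSqSum m n x i :=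
  Finset.sum_le_sum fun _ _ => natCast_le_sq _

theorem rowSqSum_le (m n : ℕ) (x : ℕ → ℕ) (i : ℕ) : rowSqSum m n x i ≤ m * rowSum m n x i := by
  rw [rowSum, Finset.mul_sum]
  refine Finset.sum_le_sum fun j _ => ?_
  rw [pow_two]
  gcongr
  exact adjCount_le _ _ _ _

theorem rowSqSum_eq (m n : ℕ) (x : ℕ → ℕ) (i : ℕ) :
    rowSqSum m n x i = rowSum m n x i + ∑ j ∈ Finset.range n, adjExcess m x i j := by
  rw [rowSum, ← Finset.sum_add_distrib]
  refine Finset.sum_congr rfl fun j _ => ?_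
  unfold adjExcess
  ring

theorem rowSum_le_blockDegree {m n : ℕ} (hm : 1 ≤ m) {x : ℕ → ℕ} (hx : IsAttachSeq (n * m) x)
    {i : ℕ} (hi : i < n) : rowSum m n x i ≤ blockDegree m n x i := by
  rw [rowSum, sum_adjCount hm hx hi]
  exact sub_le_self _ (by positivity)

theorem blockDegree_sub_le_rowSum {m n : ℕ} (hm : 1 ≤ m) {x : ℕ → ℕ} (hx : IsAttachSeq (n * m) x)
    {i : ℕ} (hi : i < n) : blockDegree m n x i - m ≤ rowSum m n x i := by
  rw [rowSum, sum_adjCount hm hx hi]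
  have : (edgeCount m x i i : ℝ) ≤ m := by exact_mod_cast edgeCount_le _ _ _ _
  linarith

theorem trace_blockMatrix_pow_four (m n : ℕ) (x : ℕ → ℕ) :
    (blockMatrix m n x ^ 4).trace = ∑ i ∈ Finset.range n, ∑ k ∈ Finset.range n,
      (((∑ j ∈ Finset.range n, adjCount m x i j * adjCount m x k j : ℕ) : ℝ)) ^ 2 := by
  have h2 : ∀ i k : Fin n, (blockMatrix m n x ^ 2) i k =
      ((∑ j ∈ Finset.range n, adjCount m x i j * adjCount m x k j : ℕ) : ℝ) := by
    intro i k
    rw [pow_two, Matrix.mul_apply, Finset.sum_range]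
    push_cast
    refine Finset.sum_congr rfl fun j _ => ?_
    rw [adjCount_comm m x k j]
    rfl
  rw [show 4 = 2 + 2 from rfl, pow_add, Matrix.trace, Finset.sum_range]
  refine Finset.sum_congr rfl fun i _ => ?_
  rw [Matrix.diag_apply, Matrix.mul_apply, Finset.sum_range]
  refine Finset.sum_congr rfl fun k _ => ?_
  rw [h2, h2, pow_two]
  congr 2
  exact Finset.sum_congr rfl fun j _ => mul_comm _ _

/-- The trace is the sum of squares of the entries of A². These are natural numbers, so off the
diagonal a square may be replaced by the entry. All entries of A² sum to the squared row sums, and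
the diagonal gives the second copy. -/
theorem trace_blockMatrix_pow_four_ge {m n : ℕ} (hm : 1 ≤ m) {x : ℕ → ℕ}
    (hx : IsAttachSeq (n * m) x) :
    2 * ∑ i ∈ Finset.range n, blockDegree m n x i * (blockDegree m n x i + 1) -
      14 * m ^ 2 * n ≤ (blockMatrix m n x ^ 4).trace := by
  have hm1 : (1 : ℝ) ≤ m := by exact_mod_cast hm
  have h1 : ∑ i ∈ Finset.range n, rowSum m n x i ^ 2 =
      ∑ i ∈ Finset.range n, ∑ k ∈ Finset.range n,
        ((∑ j ∈ Finset.range n, adjCount m x i j * adjCount m x k j : ℕ) : ℝ) := by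
    push_cast
    rw [Finset.sum_congr rfl fun i _ => Finset.sum_comm, Finset.sum_comm]
    refine Finset.sum_congr rfl fun j _ => ?_
    rw [pow_two, rowSum, Finset.sum_mul_sum]
    refine Finset.sum_congr rfl fun i _ => Finset.sum_congr rfl fun k _ => ?_
    rw [adjCount_comm m x j i, adjCount_comm m x j k]
  have h2 : ∑ i ∈ Finset.range n, rowSum m n x i ^ 2 +
      ∑ i ∈ Finset.range n, (rowSqSum m n x i ^ 2 - rowSqSum m n x i) ≤
      (blockMatrix m n x ^ 4).trace := by
    rw [h1, trace_blockMatrix_pow_four, ← Finset.sum_add_distrib]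
    refine Finset.sum_le_sum fun i hi => ?_
    rw [← le_sub_iff_add_le', ← Finset.sum_sub_distrib]
    have h3 : rowSqSum m n x i =
        ((∑ j ∈ Finset.range n, adjCount m x i j * adjCount m x i j : ℕ) : ℝ) := by
      push_cast
      exact Finset.sum_congr rfl fun j _ => pow_two _
    rw [h3]
    exact Finset.single_le_sum (f := fun k =>
      ((∑ j ∈ Finset.range n, adjCount m x i j * adjCount m x k j : ℕ) : ℝ) ^ 2 -
      ((∑ j ∈ Finset.range n, adjCount m x i j * adjCount m x k j : ℕ) : ℝ))
      (fun k _ => sub_nonneg.2 (natCast_le_sq _)) hi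
  have h3 := sum_blockDegree_cast hm hx
  -- With D the degree, both row quantities are at least D - m and `rowSqSum` is at most mD. The
  -- final constant 14 is 7m times the total degree 2mn, per m²n.
  have h4 : ∀ i ∈ Finset.range n, 2 * (blockDegree m n x i * (blockDegree m n x i + 1)) -
      7 * m * blockDegree m n x i ≤
      rowSum m n x i ^ 2 + (rowSqSum m n x i ^ 2 - rowSqSum m n x i) := by
    intro i hi
    have h5 := rowSum_le_rowSqSum m n x i
    have h6 := rowSqSum_le m n x i
    have h7 := rowSum_le_blockDegree hm hx (Finset.mem_range.1 hi)
    have h8 := blockDegree_sub_le_rowSum hm hx (Finset.mem_range.1 hi)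
    have h9 : (m : ℝ) ≤ blockDegree m n x i := by unfold blockDegree; simp
    have h10 := rowSum_nonneg m n x i
    have h11 : (blockDegree m n x i - m) ^ 2 ≤ rowSum m n x i ^ 2 :=
      pow_le_pow_left₀ (by linarith) h8 2
    have h12 : rowSum m n x i ^ 2 ≤ rowSqSum m n x i ^ 2 := pow_le_pow_left₀ h10 h5 2
    have h13 : rowSqSum m n x i ≤ m * blockDegree m n x i := h6.trans (by gcongr)
    have h14 : 0 ≤ blockDegree m n x i * (m - 1) :=
      mul_nonneg (by linarith) (by linarith)
    nlinarith [sq_nonneg (m : ℝ)]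
  rw [← Finset.sum_add_distrib] at h2
  refine le_trans (le_of_eq ?_) ((Finset.sum_le_sum h4).trans h2)
  rw [Finset.sum_sub_distrib, ← Finset.mul_sum, ← Finset.mul_sum, h3]
  ring

/-- At a leaf the previous and next vertices coincide, which in a closed walk of length 4 means w 0
= w 2 or w 1 = w 3. -/
theorem walkLeaves_eq_empty {w : Fin (3 + 1) → ℕ} (h02 : w 0 ≠ w 2) (h13 : w 1 ≠ w 3) :
    walkLeaves w = ∅ := by
  rw [walkLeaves, Finset.filter_eq_empty_iff]
  intro v hv hdeg
  obtain ⟨l, -, rfl⟩ := Finset.mem_image.1 hv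
  have h := (neighbors_of_leaf hdeg rfl).1
  fin_cases l
  · exact h13 h
  · exact h02 h.symm
  · exact h13 h.symm
  · exact h02 h

theorem prod_adjCount_four (m : ℕ) (x : ℕ → ℕ) (w : Fin (3 + 1) → ℕ) :
    ∏ l, (edgeCount m x (max (w l) (w (l + 1))) (min (w l) (w (l + 1))) : ℝ) =
      (adjCount m x (w 0) (w 1) : ℝ) * adjCount m x (w 1) (w 2) * adjCount m x (w 2) (w 3) *
        adjCount m x (w 3) (w 0) := by
  rw [Fin.prod_univ_four]
  rfl

theorem sum_rowSqSum_sq (m n : ℕ) (x : ℕ → ℕ) :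
    ∑ i ∈ Finset.range n, rowSqSum m n x i ^ 2 =
      ∑ p ∈ Finset.range n ×ˢ (Finset.range n ×ˢ Finset.range n),
        (adjCount m x p.1 p.2.1 : ℝ) ^ 2 * (adjCount m x p.1 p.2.2 : ℝ) ^ 2 := by
  rw [Finset.sum_product]
  refine Finset.sum_congr rfl fun i _ => ?_
  rw [pow_two, rowSqSum, Finset.sum_mul_sum, Finset.sum_product]

/-- Walks with w 0 = w 2 are pairs of excursions from w 0, and similarly from w 1 if w 1 = w 3;
walks of both kinds are merely counted twice. -/
theorem trace_blockMatrix_pow_four_le (m n : ℕ) (x : ℕ → ℕ) :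
    (blockMatrix m n x ^ 4).trace ≤
      ∑ w ∈ (Fintype.piFinset fun _ : Fin (3 + 1) => Finset.range n).filter
        (fun w => w 0 ≠ w 2 ∧ w 1 ≠ w 3),
        ∏ l, (edgeCount m x (max (w l) (w (l + 1))) (min (w l) (w (l + 1))) : ℝ) +
      2 * ∑ i ∈ Finset.range n, rowSqSum m n x i ^ 2 := by
  rw [show 4 = 3 + 1 from rfl, trace_blockMatrix_pow]
  set Ω := Fintype.piFinset fun _ : Fin (3 + 1) => Finset.range n with hΩ
  set f : (Fin (3 + 1) → ℕ) → ℝ := fun w =>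
    ∏ l, (edgeCount m x (max (w l) (w (l + 1))) (min (w l) (w (l + 1))) : ℝ) with hf
  have hf0 : ∀ w, 0 ≤ f w := fun w => by positivity
  have hmem : ∀ w ∈ Ω, ∀ l, w l ∈ Finset.range n := fun w hw => Fintype.mem_piFinset.1 hw
  have h1 : ∑ w ∈ Ω, f w ≤ ∑ w ∈ Ω.filter (fun w => w 0 ≠ w 2 ∧ w 1 ≠ w 3), f w +
      (∑ w ∈ Ω.filter (fun w => w 0 = w 2), f w + ∑ w ∈ Ω.filter (fun w => w 1 = w 3), f w) := by
    rw [Finset.sum_filter, Finset.sum_filter, Finset.sum_filter, ← Finset.sum_add_distrib,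
      ← Finset.sum_add_distrib]
    refine Finset.sum_le_sum fun w _ => ?_
    have := hf0 w
    by_cases h02 : w 0 = w 2 <;> by_cases h13 : w 1 = w 3 <;> simp [h02, h13, this]
  have h2 : ∑ w ∈ Ω.filter (fun w => w 0 = w 2), f w =
      ∑ i ∈ Finset.range n, rowSqSum m n x i ^ 2 := by
    rw [sum_rowSqSum_sq]
    refine Finset.sum_nbij' (fun w => (w 0, (w 1, w 3))) (fun p => ![p.1, p.2.1, p.1, p.2.2])
      ?_ ?_ ?_ ?_ ?_
    · intro w hw
      have := hmem w (Finset.mem_filter.1 hw).1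
      simp only [Finset.mem_product]
      exact ⟨this 0, this 1, this 3⟩
    · intro p hp
      simp only [Finset.mem_product] at hp
      refine Finset.mem_filter.2 ⟨Fintype.mem_piFinset.2 fun l => ?_, rfl⟩
      fin_cases l
      exacts [hp.1, hp.2.1, hp.1, hp.2.2]
    · intro w hw
      have := (Finset.mem_filter.1 hw).2
      ext l
      fin_cases l
      exacts [rfl, rfl, this, rfl]
    · intro p _
      rfl
    · intro w hw
      have := (Finset.mem_filter.1 hw).2
      simp only [hf]
      rw [prod_adjCount_four, ← this, adjCount_comm m x (w 1) (w 0), adjCount_comm m x (w 3) (w 0)]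
      ring
  have h3 : ∑ w ∈ Ω.filter (fun w => w 1 = w 3), f w =
      ∑ i ∈ Finset.range n, rowSqSum m n x i ^ 2 := by
    rw [sum_rowSqSum_sq]
    refine Finset.sum_nbij' (fun w => (w 1, (w 0, w 2))) (fun p => ![p.2.1, p.1, p.2.2, p.1])
      ?_ ?_ ?_ ?_ ?_
    · intro w hw
      have := hmem w (Finset.mem_filter.1 hw).1
      simp only [Finset.mem_product]
      exact ⟨this 1, this 0, this 2⟩
    · intro p hp
      simp only [Finset.mem_product] at hp
      refine Finset.mem_filter.2 ⟨Fintype.mem_piFinset.2 fun l => ?_, rfl⟩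
      fin_cases l
      exacts [hp.2.1, hp.1, hp.2.2, hp.1]
    · intro w hw
      have := (Finset.mem_filter.1 hw).2
      ext l
      fin_cases l
      exacts [rfl, rfl, rfl, this]
    · intro p _
      rfl
    · intro w hw
      have := (Finset.mem_filter.1 hw).2
      simp only [hf]
      rw [prod_adjCount_four, ← this, adjCount_comm m x (w 0) (w 1), adjCount_comm m x (w 2) (w 1)]
      ring
  rw [h2, h3] at h1
  linarith

/-- Writing R = r + Z with Z the multiple-edge excess, R² = r² + ZR + Zr, and R ≤ mr keeps the error
linear in Z, as the available joint moment requires. -/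
theorem rowSqSum_sq_le {m n : ℕ} (hm : 1 ≤ m) {x : ℕ → ℕ} (hx : IsAttachSeq (n * m) x) {i : ℕ}
    (hi : i < n) :
    rowSqSum m n x i ^ 2 ≤ blockDegree m n x i * (blockDegree m n x i + 1) +
      (m + 1) * (rowSum m n x i * ∑ j ∈ Finset.range n, adjExcess m x i j) := by
  have h1 := rowSqSum_le m n x i
  have h2 := rowSqSum_eq m n x i
  have h3 := rowSum_le_blockDegree hm hx hi
  have h4 := rowSum_nonneg m n x i
  have h5 : 0 ≤ ∑ j ∈ Finset.range n, adjExcess m x i j :=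
    Finset.sum_nonneg fun j _ => adjExcess_nonneg _ _ _ _
  set R := rowSqSum m n x i
  set r := rowSum m n x i
  set Z := ∑ j ∈ Finset.range n, adjExcess m x i j
  set D := blockDegree m n x i
  have h6 : r ^ 2 ≤ D * (D + 1) := by nlinarith
  have h7 : Z * R ≤ Z * (m * r) := mul_le_mul_of_nonneg_left h1 h5
  have h8 : R ^ 2 = r ^ 2 + Z * R + Z * r := by rw [h2]; ring
  nlinarith

theorem exists_attachExp_trace_pow_four_le {m : ℕ} (hm : 1 ≤ m) :
    ∃ C : ℝ, 0 < C ∧ ∀ n : ℕ, 1 ≤ n →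
      attachExp (n * m) (fun x => (blockMatrix m n x ^ 4).trace) ≤
        2 * attachExp (n * m) (fun x => ∑ i ∈ Finset.range n,
          blockDegree m n x i * (blockDegree m n x i + 1)) + C * n := by
  obtain ⟨C₁, hC₁, hlog₁⟩ := exists_log_pow_le_sqrt 4
  obtain ⟨C₂, hC₂, hlog₂⟩ := exists_log_pow_le_sqrt 2
  refine ⟨((m ^ 3 * (3 + 2) : ℕ) : ℝ) ^ (3 + 1) * ((numWalkTypes 3 + 1) * C₁) +
    2 * (m + 1) * (64 * ((m : ℝ) * m) ^ 3 * 6 * C₂ + m * (9 * ((m : ℝ) * m) ^ 2 * C₂)),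
    by positivity, fun n hn => ?_⟩
  have hn1 : (1 : ℝ) ≤ n := by exact_mod_cast hn
  have hl0 : 0 ≤ Real.log n := Real.log_nonneg hn1
  have hs1 : 1 ≤ √(n : ℝ) := Real.one_le_sqrt.2 hn1
  have hs2 : √(n : ℝ) * √n = n := Real.mul_self_sqrt (by positivity)
  have hsn : √(n : ℝ) ≤ n := by nlinarith
  have h1 := attachExp_sum_walks_le (n := n) hm
    ((Fintype.piFinset fun _ : Fin (3 + 1) => Finset.range n).filter
        (fun w => w 0 ≠ w 2 ∧ w 1 ≠ w 3))
    (fun w hw l => Finset.mem_range.1 (Fintype.mem_piFinset.1 (Finset.mem_filter.1 hw).1 l))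
    (B := (1 + Real.log n) ^ 4) (by positivity) fun w hw => by
      have h2 := (Finset.mem_filter.1 hw).2
      have h3 := prod_vertexSum_le hn w
      rwa [walkLeaves_eq_empty h2.1 h2.2, Finset.card_empty, pow_zero, one_mul] at h3
  have h2 := attachExp_sum_adjCount_mul_adjExcess_le (n := n) hm
  have h3 : attachExp (n * m) (fun x => ∑ i ∈ Finset.range n, rowSqSum m n x i ^ 2) ≤
      attachExp (n * m) (fun x => ∑ i ∈ Finset.range n,
        blockDegree m n x i * (blockDegree m n x i + 1)) +
      (m + 1) * attachExp (n * m) (fun x => ∑ i ∈ Finset.range n,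
        (∑ k ∈ Finset.range n, (adjCount m x i k : ℝ)) *
          ∑ j ∈ Finset.range n, adjExcess m x i j) := by
    rw [← attachExp_const_mul, ← attachExp_add]
    refine attachExp_mono fun x hx => ?_
    rw [Finset.mul_sum, ← Finset.sum_add_distrib]
    exact Finset.sum_le_sum fun i hi => rowSqSum_sq_le hm hx (Finset.mem_range.1 hi)
  have h4 := attachExp_mono (t := n * m) fun x _ => trace_blockMatrix_pow_four_le m n x
  rw [attachExp_add, attachExp_const_mul] at h4
  have h5 : ((m ^ 3 * (3 + 2) : ℕ) : ℝ) ^ (3 + 1) * (numWalkTypes 3 * (1 + Real.log n) ^ 4) ≤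
      ((m ^ 3 * (3 + 2) : ℕ) : ℝ) ^ (3 + 1) * ((numWalkTypes 3 + 1) * C₁) * n := by
    rw [mul_assoc _ _ (n : ℝ), mul_assoc _ _ (n : ℝ)]
    gcongr
    · linarith
    · exact (hlog₁ n hn).trans (by gcongr)
  have h6 : 64 * ((m : ℝ) * m) ^ 3 * (3 * (1 + Real.log n) * (2 * √n)) ≤
      64 * ((m : ℝ) * m) ^ 3 * 6 * C₂ * n := by
    have h7 : (1 + Real.log n) * √n ≤ C₂ * n := by
      calc _ ≤ (1 + Real.log n) ^ 2 * √n := by gcongr; nlinarith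
        _ ≤ C₂ * √n * √n := by gcongr; exact hlog₂ n hn
        _ = _ := by rw [mul_assoc, hs2]
    calc _ = 64 * ((m : ℝ) * m) ^ 3 * 6 * ((1 + Real.log n) * √n) := by ring
      _ ≤ 64 * ((m : ℝ) * m) ^ 3 * 6 * (C₂ * n) := by gcongr
      _ = _ := by ring
  have h7 : (m : ℝ) * (9 * ((m : ℝ) * m) ^ 2 * (1 + Real.log n) ^ 2) ≤
      m * (9 * ((m : ℝ) * m) ^ 2 * C₂) * n := by
    rw [mul_assoc (m : ℝ), mul_assoc (9 * ((m : ℝ) * m) ^ 2) C₂]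
    gcongr
    exact (hlog₂ n hn).trans (by gcongr)
  have h8 := mul_le_mul_of_nonneg_left (h2.trans (add_le_add h6 h7))
    (by positivity : (0 : ℝ) ≤ m + 1)
  linarith

theorem exists_abs_spectralMoment_four_sub_le {m : ℕ} (hm : 1 ≤ m) :
    ∃ C : ℝ, 0 < C ∧ ∀ n : ℕ, 1 ≤ n →
      |spectralMoment m 4 n - 2 * m * (m + 1) * Real.log n| ≤ C := by
  obtain ⟨C₁, hC₁, h₁⟩ := exists_attachExp_trace_pow_four_le hm
  obtain ⟨C₂, hC₂, h₂⟩ := exists_abs_sum_blockDegree_sub_le hm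
  refine ⟨C₁ + 14 * m ^ 2 + 2 * C₂, by positivity, fun n hn => ?_⟩
  have hn0 : (0 : ℝ) < n := by exact_mod_cast hn
  have h3 := h₁ n hn
  have h4 := abs_le.1 (h₂ n hn)
  have h5 := attachExp_mono (t := n * m) fun x hx => trace_blockMatrix_pow_four_ge hm hx
  rw [attachExp_sub, attachExp_const, attachExp_const_mul] at h5
  have h6 : spectralMoment m 4 n - 2 * m * (m + 1) * Real.log n = (n : ℝ)⁻¹ *
      (attachExp (n * m) (fun x => (blockMatrix m n x ^ 4).trace) -
        2 * (m * (m + 1) * (n * Real.log n))) := by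
    rw [spectralMoment_eq hm hn]
    field_simp
  rw [h6, abs_mul, abs_of_pos (inv_pos.2 hn0), inv_mul_le_iff₀ hn0, abs_le]
  have h7 : 0 ≤ (m : ℝ) ^ 2 * n := by positivity
  have h8 : 0 ≤ C₁ * n := by positivity
  constructor <;> nlinarith

/-! ### Asymptotics of the spectral moments -/

theorem isTheta_of_bounds {f g : ℕ → ℝ} {c C : ℝ} (hc : 0 < c) (hg : ∀ n, 1 ≤ n → 0 ≤ g n)
    (h₁ : ∀ᶠ n in atTop, c * g n ≤ f n) (h₂ : ∀ᶠ n in atTop, f n ≤ C * g n) :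
    f =Θ[atTop] g := by
  constructor
  · refine IsBigO.of_bound C ?_
    filter_upwards [h₁, h₂, eventually_ge_atTop 1] with n hn₁ hn₂ hn
    have h := hg n hn
    rw [Real.norm_of_nonneg ((mul_nonneg hc.le h).trans hn₁), Real.norm_of_nonneg h]
    exact hn₂
  · refine IsBigO.of_bound c⁻¹ ?_
    filter_upwards [h₁, eventually_ge_atTop 1] with n hn₁ hn
    have h := hg n hn
    rw [Real.norm_of_nonneg ((mul_nonneg hc.le h).trans hn₁), Real.norm_of_nonneg h,
      le_inv_mul_iff₀ hc]
    exact hn₁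

theorem inv_mul_sqrt_pow {n : ℕ} (hn : 1 ≤ n) (k : ℕ) :
    (n : ℝ)⁻¹ * √n ^ k = (n : ℝ) ^ ((k : ℝ) / 2 - 1) := by
  have hn0 : (0 : ℝ) < n := by exact_mod_cast hn
  rw [Real.sqrt_eq_rpow, ← Real.rpow_mul_natCast hn0.le, Real.rpow_sub hn0, Real.rpow_one,
    one_div_mul_eq_div]
  ring

theorem inv_mul_half_sqrt_pow {n : ℕ} (hn : 1 ≤ n) (k : ℕ) :
    (n : ℝ)⁻¹ * (√n / 2) ^ k = (1 / 2) ^ k * (n : ℝ) ^ ((k : ℝ) / 2 - 1) := by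
  rw [← inv_mul_sqrt_pow hn]
  ring

theorem spectralMoment_zero {m n : ℕ} (hm : 1 ≤ m) (hn : 1 ≤ n) : spectralMoment m 0 n = 1 := by
  rw [spectralMoment_eq hm hn]
  simp only [pow_zero, Matrix.trace_one, Fintype.card_fin, attachExp_const]
  exact inv_mul_cancel₀ (by exact_mod_cast (by omega : n ≠ 0))

theorem spectralMoment_one_isTheta {m : ℕ} (hm : 1 ≤ m) :
    spectralMoment m 1 =Θ[atTop] (fun n : ℕ => Real.log n / n) := by
  refine isTheta_of_bounds (c := 1 / 2) (C := (m * m * 2 : ℕ) * 2) (by norm_num)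
    (fun n hn => div_nonneg (Real.log_nonneg (by exact_mod_cast hn)) (by positivity)) ?_ ?_
  · filter_upwards [eventually_ge_atTop 1] with n hn
    refine le_trans (le_of_eq ?_) (spectralMoment_one_ge hm hn)
    ring
  · have hlog := (Real.tendsto_log_atTop.comp tendsto_natCast_atTop_atTop).eventually_ge_atTop 1
    filter_upwards [eventually_ge_atTop 1, hlog] with n hn h
    simp only [Function.comp_apply] at h
    refine (spectralMoment_one_le hm hn).trans ?_
    calc _ ≤ (n : ℝ)⁻¹ * ((m * m * 2 : ℕ) * (Real.log n + Real.log n)) := by gcongr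
      _ = _ := by ring

theorem spectralMoment_two_isEquivalent {m : ℕ} (hm : 1 ≤ m) :
    spectralMoment m 2 ~[atTop] (fun _ : ℕ => 2 * (m : ℝ)) := by
  have hm0 : (2 * (m : ℝ)) ≠ 0 := by positivity
  refine (isEquivalent_const_iff_tendsto hm0).2 ?_
  obtain ⟨C, hC, h⟩ := exists_abs_spectralMoment_two_sub_le hm
  rw [tendsto_iff_norm_sub_tendsto_zero]
  have h0 : Tendsto (fun n : ℕ => C * (n : ℝ) ^ (-(1 / 2) : ℝ)) atTop (nhds 0) := by
    have := (tendsto_rpow_neg_atTop (show (0 : ℝ) < 1 / 2 by norm_num)).comp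
      tendsto_natCast_atTop_atTop
    simpa using this.const_mul C
  refine squeeze_zero' (Eventually.of_forall fun _ => norm_nonneg _) ?_ h0
  filter_upwards [eventually_ge_atTop 1] with n hn
  have h1 := inv_mul_sqrt_pow hn 1
  rw [pow_one] at h1
  refine (h n hn).trans (le_of_eq ?_)
  rw [h1]
  norm_num

theorem tendsto_const_mul_log_atTop {c : ℝ} (hc : 0 < c) :
    Tendsto (fun n : ℕ => c * Real.log n) atTop atTop :=
  (Real.tendsto_log_atTop.comp tendsto_natCast_atTop_atTop).const_mul_atTop hc

theorem spectralMoment_four_isEquivalent {m : ℕ} (hm : 1 ≤ m) :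
    spectralMoment m 4 ~[atTop] (fun n : ℕ => 2 * (m : ℝ) * ((m : ℝ) + 1) * Real.log n) := by
  obtain ⟨C, hC, h⟩ := exists_abs_spectralMoment_four_sub_le hm
  have h1 : (spectralMoment m 4 - fun n : ℕ => 2 * (m : ℝ) * ((m : ℝ) + 1) * Real.log n)
      =O[atTop] (fun _ => (1 : ℝ)) := by
    refine IsBigO.of_bound C ?_
    filter_upwards [eventually_ge_atTop 1] with n hn
    simpa using h n hn
  refine h1.trans_isLittleO ((isLittleO_const_left_of_ne one_ne_zero).2 ?_)
  exact tendsto_norm_atTop_atTop.comp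
    (tendsto_const_mul_log_atTop (by positivity : 0 < 2 * (m : ℝ) * ((m : ℝ) + 1)))

theorem spectralMoment_even_isTheta {m k : ℕ} (hm : 1 ≤ m) (hk : 3 ≤ k) :
    spectralMoment m (2 * k) =Θ[atTop] (fun n : ℕ => (n : ℝ) ^ ((k : ℝ) / 2 - 1)) := by
  obtain ⟨C, hC, h⟩ := exists_spectralMoment_le (q := 2 * k - 1) hm (by omega) (by omega)
  rw [show 2 * k - 1 + 1 = 2 * k by omega, show 2 * k / 2 = k by omega] at h
  refine isTheta_of_bounds (c := (1 / 2) ^ k) (C := C) (by positivity)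
    (fun n _ => by positivity) ?_ ?_
  · filter_upwards [eventually_ge_atTop 1] with n hn
    rw [← inv_mul_half_sqrt_pow hn]
    exact (spectralMoment_ge hm hn k).1
  · filter_upwards [eventually_ge_atTop 1] with n hn
    rw [← inv_mul_sqrt_pow hn]
    exact h n hn

theorem spectralMoment_odd_isTheta {m k : ℕ} (hm : 1 ≤ m) (hk : 2 ≤ k) :
    spectralMoment m (2 * k - 1) =Θ[atTop] (fun n : ℕ => (n : ℝ) ^ ((k : ℝ) / 2 - 3 / 2)) := by
  obtain ⟨k, rfl⟩ : ∃ l, k = l + 1 := ⟨k - 1, by omega⟩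
  rw [show 2 * (k + 1) - 1 = 2 * k + 1 by omega]
  obtain ⟨C, hC, h⟩ := exists_spectralMoment_le (q := 2 * k) hm (by omega) (by omega)
  rw [show (2 * k + 1) / 2 = k by omega] at h
  have hexp : ((k + 1 : ℕ) : ℝ) / 2 - 3 / 2 = (k : ℝ) / 2 - 1 := by push_cast; ring
  rw [hexp]
  refine isTheta_of_bounds (c := (1 / 2) ^ k) (C := C) (by positivity)
    (fun n _ => by positivity) ?_ ?_
  · filter_upwards [eventually_ge_atTop 1] with n hn
    rw [← inv_mul_half_sqrt_pow hn]
    exact (spectralMoment_ge hm hn k).2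
  · filter_upwards [eventually_ge_atTop 1] with n hn
    rw [← inv_mul_sqrt_pow hn]
    exact h n hn

/-- Beyond order 4 the lower bound has exponent ⌊j/2⌋/2 - 1, which is positive from j = 6 on and
zero at j = 5. -/
theorem tendsto_spectralMoment_atTop {m j : ℕ} (hm : 1 ≤ m) (hj : 4 ≤ j) (hj5 : j ≠ 5) :
    Tendsto (spectralMoment m j) atTop atTop := by
  rcases eq_or_ne j 4 with rfl | hj4
  · exact (spectralMoment_four_isEquivalent hm).symm.tendsto_atTop
      (tendsto_const_mul_log_atTop (by positivity))
  obtain ⟨k, hk⟩ : ∃ k, k = j / 2 := ⟨_, rfl⟩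
  have hk3 : 3 ≤ k := by omega
  have h0 : Tendsto (fun n : ℕ => (1 / 2 : ℝ) ^ k * (n : ℝ) ^ ((k : ℝ) / 2 - 1)) atTop atTop := by
    have h1 : (0 : ℝ) < (k : ℝ) / 2 - 1 := by
      have : (3 : ℝ) ≤ k := by exact_mod_cast hk3
      linarith
    exact ((tendsto_rpow_atTop h1).comp tendsto_natCast_atTop_atTop).const_mul_atTop
      (by positivity)
  refine tendsto_atTop_mono' _ ?_ h0
  filter_upwards [eventually_ge_atTop 1] with n hn
  rw [← inv_mul_half_sqrt_pow hn]
  rcases Nat.even_or_odd' j with ⟨l, rfl | rfl⟩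
  · obtain rfl : k = l := by omega
    exact (spectralMoment_ge hm hn k).1
  · obtain rfl : k = l := by omega
    exact (spectralMoment_ge hm hn k).2

theorem theorem1 (m : ℕ) (hm : 1 ≤ m) :
    (∀ n : ℕ, 1 ≤ n → spectralMoment m 0 n = 1) ∧
    spectralMoment m 1 =Θ[atTop] (fun n : ℕ => Real.log n / n) ∧
    spectralMoment m 2 ~[atTop] (fun _ : ℕ => 2 * (m : ℝ)) ∧
    spectralMoment m 3 =Θ[atTop] (fun n : ℕ => (n : ℝ) ^ (-(1 / 2) : ℝ)) ∧
    spectralMoment m 4 ~[atTop] (fun n : ℕ => 2 * (m : ℝ) * ((m : ℝ) + 1) * Real.log n) ∧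
    (∀ k : ℕ, 3 ≤ k →
      spectralMoment m (2 * k) =Θ[atTop] (fun n : ℕ => (n : ℝ) ^ ((k : ℝ) / 2 - 1)) ∧
      spectralMoment m (2 * k - 1) =Θ[atTop] (fun n : ℕ => (n : ℝ) ^ ((k : ℝ) / 2 - 3 / 2))) ∧
    (∀ j : ℕ, 4 ≤ j → j ≠ 5 → Tendsto (spectralMoment m j) atTop atTop) := by
  refine ⟨fun n hn => spectralMoment_zero hm hn, spectralMoment_one_isTheta hm,
    spectralMoment_two_isEquivalent hm, ?_, spectralMoment_four_isEquivalent hm,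
    fun k hk => ⟨spectralMoment_even_isTheta hm hk, spectralMoment_odd_isTheta hm (by omega)⟩,
    fun j hj hj5 => tendsto_spectralMoment_atTop hm hj hj5⟩
  have h := spectralMoment_odd_isTheta hm (le_refl 2)
  have hexp : ((2 : ℕ) : ℝ) / 2 - 3 / 2 = -(1 / 2) := by norm_num
  rwa [hexp] at h
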